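/- Let $n\ge 0$ be an integer. Let $E\subset\mathbb{R}^{n+1}$ be the hyperplane of vectors with coordinate sum zero, with simple roots $\alpha_i=\varepsilon_i-\varepsilon_{i+1}$ and fundamental weights $\varpi_1,\dots,\varpi_n\in E$ defined by $(\varpi_i,\alpha_j)=\delta_{ij}$. For $\lambda\in E$ let $\mathsf{P}_n(\lambda)\subset E$ be the permutohedron, i.e. the convex hull of the orbit of $\lambda$ under permutations of the coordinates, and let $\mathrm{Vol}_n$ be the Euclidean volume on $E$. For integers $1\le i,j\le d$ put $c_{d,i,j}=\min\{i,j\}-\frac{ij}{d+1}$ (the $(i,j)$ entry of the inverse of the Cartan matrix of type $A_d$), and for $u\ge 0$ let $$\Gamma_{d,i}[u]=\frac1d\binom{d+1}{i}\sum_{j=1}^{d}c_{d,i,j}\,x_{j+u}\in\mathbb{R}[x_1,x_2,\dots].$$ An $n$-Dyck path is a lattice path from $(0,0)$ to $(n,n)$ with $n$ north steps $(0,1)$ and $n$ east steps $(1,0)$ that never goes below the diagonal $y=x$; let $\mathcal{D}_n$ be the set of all of them. For a north step $N$ of $D\in\mathcal{D}_n$ with initial point $P_N=(u,u')$, let $D_N$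 be the part of $D$ from $P_N$ to $(n,n)$, translated by $-P_N$, and let $K$ be the (non-empty) set of integers $1\le k\le n-u$ such that $D_N$ passes through $(k,k)$ and its part from $(0,0)$ to $(k,k)$ is a $k$-Dyck path. With $d=\max K$ and $i=\min K$, set $c_N=c_{d,i,i}$ and $\Gamma_N=\Gamma_{d,i}[u]$. Finally let $c_D=\prod_{N\in D}c_N$ and $\Gamma_D=\prod_{N\in D}\Gamma_N$, the products being over all north steps of $D$. Then: 1. $c_D=\dfrac{1}{n+1}$ for every $D\in\mathcal{D}_n$. 2. There is a unique polynomial $\mathcal{V}_n\in\mathbb{R}[x_1,x_2,\dots]$ such that $\mathcal{V}_n(x_1,x_2,\dots)=\mathrm{Vol}_n\big(\mathsf{P}_n(x_1\varpi_1+\cdots+x_n\varpi_n)\big)$ whenever $x_1,\dots,x_n\ge 0$, and it is $$\mathcal{V}_n=\sqrt{n+1}\,\sum_{D\in\mathcal{D}_n}\Gamma_D .$$ 3. Equivalently, if the volume on $E$ is instead normalized (as Postnikov does) so that the parallelepiped spanned by the simple roots $\alpha_1,\dots,\alpha_n$ has volume $1$, then for all $x_1,\dots,x_n\ge 0$ the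 volume of $\mathsf{P}_n(x_1\varpi_1+\cdots+x_n\varpi_n)$ is $\sum_{D\in\mathcal{D}_n}\Gamma_D(x_1,\dots,x_n)$. -/

import Mathlib

open MeasureTheory

noncomputable section

namespace DyckVolume

/-! ### The permutohedron in type `A_n` -/

/-- The hyperplane `E ⊆ ℝ^{n+1}` of vectors with coordinate sum zero, with the Euclidean
inner product. -/
abbrev E (n : ℕ) : Submodule ℝ (EuclideanSpace ℝ (Fin (n + 1))) where
  carrier := {v | ∑ k, v k = 0}
  add_mem' := by
    intro a b ha hb
    simp only [Set.mem_ofPred_eq, PiLp.add_apply, Finset.sum_add_distrib] at *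
    rw [ha, hb, add_zero]
  zero_mem' := by simp
  smul_mem' := by
    intro c a ha
    simp only [Set.mem_ofPred_eq, PiLp.smul_apply, smul_eq_mul, ← Finset.mul_sum] at *
    rw [ha, mul_zero]

/-- The simple root `α_{i+1} = ε_{i+1} - ε_{i+2}` (the index `i : Fin n` starts at `0`). -/
def simpleRoot (n : ℕ) (i : Fin n) : E n :=
  ⟨EuclideanSpace.single i.castSucc 1 - EuclideanSpace.single i.succ 1, by
    simp [Finset.sum_sub_distrib]⟩

/-- The fundamental weight `ϖ_{i+1}` (the index `i : Fin n` starts at `0`):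
its first `i + 1` coordinates are `1 - (i+1)/(n+1)`, the others are `-(i+1)/(n+1)`. -/
def fundamentalWeight (n : ℕ) (i : Fin n) : E n :=
  ⟨WithLp.toLp 2 fun k : Fin (n + 1) =>
      (if k ≤ i.castSucc then 1 else 0) - ((i : ℝ) + 1) / ((n : ℝ) + 1), by
    have h : (Finset.univ.filter fun k : Fin (n + 1) => k ≤ i.castSucc).card = (i : ℕ) + 1 := by
      have : (Finset.univ.filter fun k : Fin (n + 1) => k ≤ i.castSucc)
          = Finset.Iic i.castSucc := by ext; simp
      rw [this, Fin.card_Iic]; simp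
    have hn : (n : ℝ) + 1 ≠ 0 := by positivity
    simp only [Submodule.mem_mk, AddSubmonoid.mem_mk, AddSubsemigroup.mem_mk, Set.mem_ofPred_eq,
      Finset.sum_sub_distrib, Finset.sum_boole, h, Finset.sum_const, Finset.card_univ,
      Fintype.card_fin, nsmul_eq_mul]
    push_cast
    field_simp
    ring⟩

/-- The fundamental weights are dual to the simple roots: `(ϖ_i, α_j) = δ_{ij}`. -/
theorem inner_fundamentalWeight_simpleRoot (n : ℕ) (i j : Fin n) :
    inner ℝ (fundamentalWeight n i) (simpleRoot n j) = if i = j then 1 else 0 := by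
  rw [Submodule.coe_inner]
  simp only [fundamentalWeight, simpleRoot, inner_sub_right, EuclideanSpace.inner_single_right,
    Fin.le_def, Fin.val_castSucc, Fin.val_succ, Fin.ext_iff]
  by_cases h : (i : ℕ) = j
  · simp [h]
  · rcases lt_or_gt_of_ne h with h' | h'
    · have h1 : ¬ ((j : ℕ) ≤ i) := by omega
      have h2 : ¬ ((j : ℕ) + 1 ≤ i) := by omega
      simp [h, h1, h2]
    · have h1 : ((j : ℕ) ≤ i) := by omega
      have h2 : ((j : ℕ) + 1 ≤ i) := by omega
      simp [h, h1, h2]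

/-- The action of the Weyl group `𝔖_{n+1}` on `E` by permutation of the coordinates. -/
def permute {n : ℕ} (w : Equiv.Perm (Fin (n + 1))) (v : E n) : E n :=
  ⟨WithLp.toLp 2 fun k => (v : EuclideanSpace ℝ (Fin (n + 1))) (w.symm k), by
    have hv : ∑ k, (v : EuclideanSpace ℝ (Fin (n + 1))) k = 0 := v.2
    simp only [Submodule.mem_mk, AddSubmonoid.mem_mk, AddSubsemigroup.mem_mk, Set.mem_ofPred_eq]
    rw [← hv]
    exact Equiv.sum_comp w.symm fun k => (v : EuclideanSpace ℝ (Fin (n + 1))) k⟩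

/-- The permutohedron `P_n(v)`: the convex hull of the Weyl group orbit of `v`. -/
def permutohedron {n : ℕ} (v : E n) : Set (E n) :=
  convexHull ℝ (Set.range fun w : Equiv.Perm (Fin (n + 1)) => permute w v)

/-- The vector `x_1 ϖ_1 + ⋯ + x_n ϖ_n`. -/
def weightVector (n : ℕ) (x : ℕ → ℝ) : E n :=
  ∑ i : Fin n, x (i + 1) • fundamentalWeight n i

/-- The Euclidean (`n`-dimensional) volume on `E`: the translation invariant measure for which the
parallelepiped spanned by an orthonormal basis of `E` has measure `1`. (The bare `volume` is
avoided, since on a subspace it could mean the restriction of the ambient measure.) -/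
def euclideanVolume (n : ℕ) : Measure (E n) :=
  (stdOrthonormalBasis ℝ (E n)).toBasis.addHaar

/-- `V` is the volume polynomial `𝒱_n` of the permutohedron:
`V(x_1, x_2, …) = Vol_n (P_n (x_1 ϖ_1 + ⋯ + x_n ϖ_n))` for all `x_1, …, x_n ≥ 0`.
Polynomials live in `ℝ[x_1, x_2, …]`; the variable `x_j` is `X j`, and `X 0` is never used. -/
def IsVolumePolynomial (n : ℕ) (V : MvPolynomial ℕ ℝ) : Prop :=
  ∀ x : ℕ → ℝ, (∀ j ∈ Finset.Icc 1 n, 0 ≤ x j) →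
    MvPolynomial.eval x V = (euclideanVolume n).real (permutohedron (weightVector n x))

/-! ### The linear forms `Γ_{d,i}` -/

/-- `c_{d,i,j} = min {i,j} - i j / (d+1)`, the `(i,j)` entry, `1 ≤ i, j ≤ d`, of the inverse of the
Cartan matrix of type `A_d`. -/
def cartanInv (d i j : ℕ) : ℝ := (min i j : ℕ) - (i : ℝ) * j / ((d : ℝ) + 1)

theorem cartanMatrix_inv_apply (d : ℕ) (i j : Fin d) :
    ((CartanMatrix.A d).map (Int.cast : ℤ → ℝ))⁻¹ i j = cartanInv d (i + 1) (j + 1) := by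
  have key : (CartanMatrix.A d).map (Int.cast : ℤ → ℝ) *
      Matrix.of (fun i j : Fin d => cartanInv d (i + 1) (j + 1)) = 1 := by
    ext i j
    have hd : (d : ℝ) + 1 ≠ 0 := by positivity
    have hi := i.2
    have hj := j.2
    have e : ∀ k : Fin d, (((CartanMatrix.A d i k : ℤ)) : ℝ) * cartanInv d (k + 1) (j + 1) =
        (((if (k : ℕ) = i then 2 * cartanInv d (k + 1) (j + 1) else 0)
          - (if (k : ℕ) = i + 1 then cartanInv d (k + 1) (j + 1) else 0))
          - (if (k : ℕ) + 1 = i then cartanInv d (k + 1) (j + 1) else 0)) := by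
      intro k
      simp only [CartanMatrix.A, Matrix.of_apply, Fin.ext_iff]
      split_ifs <;> first | omega | (push_cast; ring)
    have s1 : ∑ k ∈ Finset.range d,
        (if k = (i : ℕ) + 1 then cartanInv d (k + 1) (j + 1) else 0)
        = cartanInv d (i + 2) (j + 1) := by
      rw [Finset.sum_ite_eq']
      split_ifs with h
      · rfl
      · have h' : (i : ℕ) + 2 = d + 1 := by rw [Finset.mem_range] at h; omega
        rw [h', cartanInv, min_eq_right (by omega)]
        push_cast
        field_simp
        ring
    have s2 : ∑ k ∈ Finset.range d,
        (if k + 1 = (i : ℕ) then cartanInv d (k + 1) (j + 1) else 0)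
        = cartanInv d i (j + 1) := by
      rcases Nat.eq_zero_or_pos (i : ℕ) with h | h
      · rw [h]; simp [cartanInv]
      · rw [Finset.sum_eq_single ((i : ℕ) - 1)]
        · rw [Nat.sub_add_cancel h]; simp
        · intro b _ hb
          exact if_neg (by omega)
        · intro hb; rw [Finset.mem_range] at hb; omega
    rw [Matrix.mul_apply]
    simp only [Matrix.map_apply, Matrix.of_apply, e, Finset.sum_sub_distrib]
    rw [Fin.sum_univ_eq_sum_range
        (fun k => if k = (i : ℕ) then 2 * cartanInv d (k + 1) (j + 1) else 0),
      Fin.sum_univ_eq_sum_range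
        (fun k => if k = (i : ℕ) + 1 then cartanInv d (k + 1) (j + 1) else 0),
      Fin.sum_univ_eq_sum_range
        (fun k => if k + 1 = (i : ℕ) then cartanInv d (k + 1) (j + 1) else 0), s1, s2,
      Finset.sum_ite_eq', if_pos (Finset.mem_range.2 hi), Matrix.one_apply]
    simp only [cartanInv, Fin.ext_iff]
    rcases lt_trichotomy (i : ℕ) j with h | h | h
    · rw [if_neg (by omega), min_eq_left (by omega), min_eq_left (by omega),
        min_eq_left (by omega)]
      push_cast
      ring
    · rw [if_pos h, ← h, min_eq_left (by omega), min_eq_right (by omega),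
        min_eq_left (by omega)]
      push_cast
      ring
    · rw [if_neg (by omega), min_eq_right (by omega), min_eq_right (by omega),
        min_eq_right (by omega)]
      push_cast
      ring
  rw [Matrix.inv_eq_right_inv key, Matrix.of_apply]

/-- `Γ_{d,i} = (1/d) * binom(d+1, i) * ∑_{j=1}^d c_{d,i,j} x_j`. -/
def gammaForm (d i : ℕ) : MvPolynomial ℕ ℝ :=
  MvPolynomial.C (1 / (d : ℝ) * ((d + 1).choose i : ℝ)) *
    ∑ j ∈ Finset.Icc 1 d, MvPolynomial.C (cartanInv d i j) * MvPolynomial.X j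

/-- The shift `p[u](x_1, x_2, …) = p(x_{1+u}, x_{2+u}, …)`. -/
def shift (u : ℕ) (p : MvPolynomial ℕ ℝ) : MvPolynomial ℕ ℝ :=
  MvPolynomial.rename (fun j => j + u) p

/-! ### Dyck paths -/

/-- `n`-Dyck paths, as Dyck words: the letter `U` is a north step, the letter `D` an east step. -/
abbrev DyckPath (n : ℕ) : Type := {p : DyckWord // p.semilength = n}

namespace DyckPath

variable {n : ℕ}

/-- The positions (counted from `0`) in the word at which the path makes a north step. -/
def northSteps (D : DyckPath n) : Finset ℕ :=
  (Finset.range D.1.toList.length).filter fun t => D.1.toList[t]? = some DyckStep.U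

/-- The abscissa `u` of the point at which the step at position `t` starts. -/
def abscissa (D : DyckPath n) (t : ℕ) : ℕ := (D.1.toList.take t).count DyckStep.D

/-- For the step `N` at position `t`, with initial point `P_N = (u, u')`: the set `K` of
`1 ≤ k ≤ n - u` for which the remaining path `D_N`, translated to start at the origin, passes
through `(k,k)` and its part from `(0,0)` to `(k,k)` is a `k`-Dyck path. -/
def returnSet (D : DyckPath n) (t : ℕ) : Set ℕ :=
  {k | 1 ≤ k ∧ k ≤ n - D.abscissa t ∧
    ∃ q : DyckPath k, q.1.toList <+: D.1.toList.drop t}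

/-- `d = max K`. -/
def maxReturn (D : DyckPath n) (t : ℕ) : ℕ := sSup (D.returnSet t)

/-- `i = min K`. -/
def minReturn (D : DyckPath n) (t : ℕ) : ℕ := sInf (D.returnSet t)

/-- `c_D`, the product of `c_N = c_{d,i,i}` over the north steps `N` of `D`. -/
def cartanProd (D : DyckPath n) : ℝ :=
  ∏ t ∈ D.northSteps, cartanInv (D.maxReturn t) (D.minReturn t) (D.minReturn t)

/-- `Γ_D`, the product of `Γ_N = Γ_{d,i}[u]` over the north steps `N` of `D`. -/
def gammaPoly (D : DyckPath n) : MvPolynomial ℕ ℝ :=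
  ∏ t ∈ D.northSteps, shift (D.abscissa t) (gammaForm (D.maxReturn t) (D.minReturn t))

end DyckPath

end DyckVolume

end

/-! Volume and Dyck sum satisfy the same quadratic recursion. Write the weight as a decreasing
sequence l_0 ≥ … ≥ l_n with x_{k+1} = l_k - l_{k+1}, and forget one coordinate of E. By Rado's
theorem (`mem_permutohedron_iff`) the permutohedron is cut out by majorization inequalities. Fixing
a further coordinate at t in [l_{j+1}, l_j] leaves the projected permutohedron of the sequence in
which l_j, l_{j+1} are replaced by the single entry l_j + l_{j+1} - t
(`cons_mem_projPermutohedron`). So by Fubini the volume is a polynomial q_n(l), obtained by iterated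
integration (`interlacePoly`, `volume_projPermutohedron`).

The key identity (`rootDeriv_interlacePoly`) is (∂_k - ∂_{k+1}) q_{n+1} = binom(n+2, k+1) q_k(l_0,
…, l_k) q_{n-k}(l_{k+1}, …, l_{n+1}). Geometrically, the facets of one type are binom(n+2, k+1)
products of two smaller permutohedra; the proof itself is an induction resting on Pascal's rule.
Since q_{n+1} is homogeneous of degree n+1 and unchanged when a constant is added to all l_k,
Euler's identity and Abel summation turn this into q_{n+1} = ∑_i Γ_{n+1,i+1} q_i q_{n-i}[i+1].

A nonempty Dyck path is U p D q, cut at its first return. Its first step has d = n+1 and i = |p| +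
1, while the return sets of the other north steps are those computed inside p or q
(`stepProd_nest_add`). Hence ∑ Γ_D obeys the recursion of q_n (`gammaSum_succ`), and c_D = 1/(n+1)
follows by the same induction.

Finally, the basis ε_i - ε_0 of E differs from the simple roots by a unimodular matrix, and its Gram
matrix I + J (J all ones) has determinant n+1; this gives the two normalizations. Uniqueness holds
because a polynomial is determined by its values on the nonnegative orthant. -/

noncomputable section

namespace DyckVolume

/-! ### The decomposition of Dyck paths at the first return -/

/-- The positive semilengths of the Dyck words that are prefixes of `l`. -/
def dyckPrefixes (l : List DyckStep) : Set ℕ :=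
  {k | 1 ≤ k ∧ ∃ q : DyckWord, q.semilength = k ∧ q.toList <+: l}

/-- The product of `f u d i` over the north steps of a Dyck word, where `u` is the abscissa of the
step and `d` and `i` are the extremal elements of its set of returns. -/
def stepProd {M : Type*} [CommMonoid M] (f : ℕ → ℕ → ℕ → M) (p : DyckWord) : M :=
  ∏ t ∈ Finset.range p.toList.length,
    if p.toList[t]? = some DyckStep.U then
      f ((p.toList.take t).count DyckStep.D) (sSup (dyckPrefixes (p.toList.drop t)))
        (sInf (dyckPrefixes (p.toList.drop t)))
    else 1

/-- The bound k ≤ n - u is automatic: only n - u east steps remain. What is left depends on the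
remaining word alone, not on n. -/
theorem DyckPath.returnSet_eq {n : ℕ} (D : DyckPath n) (t : ℕ) :
    D.returnSet t = dyckPrefixes (D.1.toList.drop t) := by
  ext k
  constructor
  · rintro ⟨h1, -, q, hq⟩
    exact ⟨h1, q.1, q.2, hq⟩
  · rintro ⟨h1, q, hk, hq⟩
    refine ⟨h1, ?_, ⟨q, hk⟩, hq⟩
    have h2 := hq.count_le DyckStep.D
    rw [← DyckWord.semilength_eq_count_D, hk] at h2
    have h3 : (D.1.toList.take t).count DyckStep.D + (D.1.toList.drop t).count DyckStep.D = n := by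
      rw [← List.count_append, List.take_append_drop, ← DyckWord.semilength_eq_count_D, D.2]
    unfold DyckPath.abscissa
    omega

theorem DyckPath.prod_northSteps {n : ℕ} {M : Type*} [CommMonoid M] (f : ℕ → ℕ → ℕ → M)
    (D : DyckPath n) :
    ∏ t ∈ D.northSteps, f (D.abscissa t) (D.maxReturn t) (D.minReturn t) = stepProd f D.1 := by
  simp only [DyckPath.northSteps, Finset.prod_filter, stepProd, DyckPath.abscissa,
    DyckPath.maxReturn, DyckPath.minReturn, DyckPath.returnSet_eq]

theorem count_U_drop_le (p : DyckWord) (t : ℕ) :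
    (p.toList.drop t).count DyckStep.U ≤ (p.toList.drop t).count DyckStep.D := by
  have h1 := p.count_U_eq_count_D
  rw [← List.take_append_drop t p.toList, List.count_append, List.count_append] at h1
  have := p.count_D_le_count_U t
  omega

theorem count_D_le_of_prefix {q : DyckWord} {l : List DyckStep} (h : l <+: q.toList) :
    l.count DyckStep.D ≤ l.count DyckStep.U := by
  rw [List.prefix_iff_eq_take.1 h]
  exact q.count_D_le_count_U _

/-- A suffix of a Dyck word has at least as many D as U, so one further D gives a word that is not a
prefix of any Dyck word. The returns of a step inside p are therefore not affected by what follows p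
in U p D q. -/
theorem dyckPrefixes_drop_append (p : DyckWord) (t : ℕ) (l : List DyckStep) :
    dyckPrefixes (p.toList.drop t ++ DyckStep.D :: l) = dyckPrefixes (p.toList.drop t) := by
  ext k
  refine and_congr_right fun _ => exists_congr fun q => and_congr_right fun _ => ⟨fun h => ?_,
    fun h => h.trans (List.prefix_append _ _)⟩
  have h2 : p.toList.drop t ++ [DyckStep.D] <+: p.toList.drop t ++ DyckStep.D :: l := by
    rw [List.prefix_append_right_inj]; simp
  rcases List.prefix_or_prefix_of_prefix h h2 with h3 | h3
  · rcases List.prefix_concat_iff.1 h3 with h4 | h4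
    · have := count_D_le_of_prefix (q := q) (l := p.toList.drop t ++ [DyckStep.D]) (by rw [h4])
      have := count_U_drop_le p t
      simp [List.count_append] at *
      omega
    · exact h4
  · have := count_D_le_of_prefix h3
    have := count_U_drop_le p t
    simp [List.count_append] at *
    omega

theorem toList_nest_add (p q : DyckWord) :
    (p.nest + q).toList = DyckStep.U :: (p.toList ++ DyckStep.D :: q.toList) := by
  change ([DyckStep.U] ++ p.toList ++ [DyckStep.D]) ++ q.toList = _
  simp

theorem sSup_dyckPrefixes {p : DyckWord} (hp : 1 ≤ p.semilength) :
    sSup (dyckPrefixes p.toList) = p.semilength := by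
  refine IsGreatest.csSup_eq ⟨⟨hp, p, rfl, List.prefix_rfl⟩, ?_⟩
  rintro k ⟨-, q, rfl, h⟩
  exact h.count_le _

theorem sInf_dyckPrefixes (p q : DyckWord) :
    sInf (dyckPrefixes (p.nest + q).toList) = p.semilength + 1 := by
  refine IsLeast.csInf_eq ⟨⟨by omega, p.nest, by simp, List.prefix_append _ _⟩, ?_⟩
  rintro k ⟨h1, r, rfl, h⟩
  by_contra! hlt
  rw [toList_nest_add] at h
  have hlen := r.two_mul_semilength_eq_length
  have hp := p.two_mul_semilength_eq_length
  cases hr : r.toList with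
  | nil => rw [hr, List.length_nil] at hlen; omega
  | cons a s =>
    rw [hr, List.cons_prefix_cons] at h
    rw [hr, List.length_cons] at hlen
    obtain ⟨rfl, h⟩ := h
    -- A shorter nonempty Dyck prefix would be U s with s a prefix of p; but s has one more D than
    -- U.
    have hs : s <+: p.toList :=
      List.prefix_of_prefix_length_le h (List.prefix_append _ _) (by omega)
    have := count_D_le_of_prefix hs
    have := r.count_U_eq_count_D
    rw [hr] at this
    simp at this
    omega

theorem stepProd_zero {M : Type*} [CommMonoid M] (f : ℕ → ℕ → ℕ → M) : stepProd f 0 = 1 := by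
  have : (0 : DyckWord).toList = [] := rfl
  simp [stepProd, this]

theorem stepProd_nest_add {M : Type*} [CommMonoid M] (f : ℕ → ℕ → ℕ → M) (p q : DyckWord) :
    stepProd f (p.nest + q) = f 0 (p.semilength + q.semilength + 1) (p.semilength + 1) *
      stepProd f p * stepProd (fun u => f (u + (p.semilength + 1))) q := by
  have hs : (p.nest + q).semilength = p.semilength + q.semilength + 1 := by
    simp; omega
  have h0 := sSup_dyckPrefixes (p := p.nest + q) (by omega)
  have h1 := sInf_dyckPrefixes p q
  unfold stepProd
  rw [hs] at h0
  rw [toList_nest_add] at *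
  have hlen : (DyckStep.U :: (p.toList ++ DyckStep.D :: q.toList)).length
      = p.toList.length + (q.toList.length + 1) + 1 := by simp
  -- The positions split into the initial U, the letters of p, the closing D (factor 1) and the
  -- letters of q.
  rw [hlen, Finset.prod_range_succ', Finset.prod_range_add, Finset.prod_range_succ']
  simp only [List.getElem?_cons_zero, List.take_zero, List.drop_zero, h0, h1, if_true,
    List.count_nil, List.getElem?_cons_succ, List.take_succ_cons, List.drop_succ_cons]
  rw [mul_comm, mul_assoc]
  congr 2
  · refine Finset.prod_congr rfl fun t ht => ?_
    rw [Finset.mem_range] at ht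
    rw [List.getElem?_append_left ht, List.take_append_of_le_length ht.le,
      List.drop_append_of_le_length ht.le, dyckPrefixes_drop_append]
    simp
  · simp only [List.getElem?_append_right le_rfl, Nat.sub_self, List.getElem?_cons_zero,
      Option.some.injEq, reduceCtorEq, if_false, mul_one]
    refine Finset.prod_congr rfl fun t _ => ?_
    rw [List.getElem?_append_right (by omega), List.take_append, List.drop_append]
    simp only [Nat.add_sub_cancel_left, List.getElem?_cons_succ, List.take_succ_cons,
      List.drop_succ_cons]
    rw [List.take_of_length_le (by omega), List.drop_of_length_le (by omega)]
    simp [List.count_append, DyckWord.semilength_eq_count_D, add_left_comm]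

theorem sum_dyckPath_succ {M : Type*} [AddCommMonoid M] (g : DyckWord → M) (n : ℕ) :
    ∑ D : DyckPath (n + 1), g D.1 = ∑ ab ∈ Finset.HasAntidiagonal.antidiagonal n,
      ∑ p : DyckPath ab.1, ∑ q : DyckPath ab.2, g (p.1.nest + q.1) := by
  simp_rw [← Fintype.sum_prod_type']
  rw [Finset.sum_sigma']
  symm
  refine Finset.sum_bij (fun x _ => ⟨x.2.1.1.nest + x.2.2.1, ?_⟩) ?_ ?_ ?_ ?_
  · rename_i x hx
    have := x.2.1.2
    have := x.2.2.2
    simp only [Finset.mem_sigma, Finset.HasAntidiagonal.mem_antidiagonal] at hx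
    simp only [DyckWord.semilength_add, DyckWord.semilength_nest]
    omega
  · intro _ _
    exact Finset.mem_univ _
  · rintro ⟨⟨a, b⟩, ⟨p, hp⟩, ⟨q, hq⟩⟩ _ ⟨⟨a', b'⟩, ⟨p', hp'⟩, ⟨q', hq'⟩⟩ _ h
    have h' : p.nest + q = p'.nest + q' := congrArg Subtype.val h
    have h1 : p = p' := by simpa using congrArg DyckWord.insidePart h'
    have h2 : q = q' := by simpa using congrArg DyckWord.outsidePart h'
    dsimp only at hp hq hp' hq'
    subst h1 h2 hp hq hp' hq'
    rfl
  · intro D _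
    have hD : D.1 ≠ 0 := by
      intro h
      have := D.2
      rw [h] at this
      simp at this
    refine ⟨⟨(D.1.insidePart.semilength, D.1.outsidePart.semilength), ⟨D.1.insidePart, rfl⟩,
      ⟨D.1.outsidePart, rfl⟩⟩, ?_, ?_⟩
    · have := DyckWord.semilength_insidePart_add_semilength_outsidePart_add_one hD
      have := D.2
      simp
      omega
    · exact Subtype.ext (DyckWord.nest_insidePart_add_outsidePart hD)
  · intro _ _
    rfl

/-- With |p| = a and |q| = b, the first step of U p D q contributes (a+1)(b+1)/(a+b+2), which
cancels the inductive values 1/(a+1) and 1/(b+1). -/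
theorem stepProd_cartanInv (p : DyckWord) :
    stepProd (fun _ d i => cartanInv d i i) p = 1 / ((p.semilength : ℝ) + 1) := by
  by_cases h : p = 0
  · subst h
    simp [stepProd_zero]
  · rw [← DyckWord.nest_insidePart_add_outsidePart h, stepProd_nest_add,
      stepProd_cartanInv p.insidePart, stepProd_cartanInv p.outsidePart]
    simp only [cartanInv, min_self, DyckWord.semilength_add, DyckWord.semilength_nest]
    push_cast
    have h1 : (p.insidePart.semilength : ℝ) + 1 ≠ 0 := by positivity
    have h2 : (p.outsidePart.semilength : ℝ) + 1 ≠ 0 := by positivity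
    have h3 : (p.insidePart.semilength : ℝ) + p.outsidePart.semilength + 1 + 1 ≠ 0 := by positivity
    have h4 : (p.insidePart.semilength : ℝ) + 1 + p.outsidePart.semilength + 1 ≠ 0 := by positivity
    field_simp
    ring
termination_by p.semilength
decreasing_by
  exacts [DyckWord.semilength_insidePart_lt h, DyckWord.semilength_outsidePart_lt h]

theorem DyckPath.cartanProd_eq {n : ℕ} (D : DyckPath n) : D.cartanProd = 1 / ((n : ℝ) + 1) := by
  have := stepProd_cartanInv D.1
  rw [D.2, ← DyckPath.prod_northSteps] at this
  exact this

/-- The sum of `Γ_D` over all `n`-Dyck paths. -/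
def gammaSum (n : ℕ) : MvPolynomial ℕ ℝ := ∑ D : DyckPath n, D.gammaPoly

theorem DyckPath.gammaPoly_eq {n : ℕ} (D : DyckPath n) :
    D.gammaPoly = stepProd (fun u d i => shift u (gammaForm d i)) D.1 :=
  D.prod_northSteps fun u d i => shift u (gammaForm d i)

theorem shift_shift (u v : ℕ) (p : MvPolynomial ℕ ℝ) : shift u (shift v p) = shift (v + u) p := by
  simp only [shift, MvPolynomial.rename_rename]
  congr 2
  ext j
  simp [add_assoc]

theorem gammaSum_zero : gammaSum 0 = 1 := by
  have h : ∀ D : DyckPath 0, D.1 = 0 := by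
    rintro ⟨p, hp⟩
    change p = 0
    by_contra h
    have := DyckWord.semilength_insidePart_lt h
    omega
  have h1 : Fintype.card (DyckPath 0) = 1 := by
    rw [DyckWord.card_dyckWord_semilength_eq_catalan]; simp
  unfold gammaSum
  rw [Finset.sum_congr rfl fun D _ => by rw [D.gammaPoly_eq, h D, stepProd_zero]]
  simp [h1]

/-- First-return decomposition: i = |p| + 1, and the steps of q start |p| + 1 further to the right,
whence the shift. -/
theorem gammaSum_succ (n : ℕ) :
    gammaSum (n + 1) = ∑ ab ∈ Finset.HasAntidiagonal.antidiagonal n,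
      gammaForm (n + 1) (ab.1 + 1) * gammaSum ab.1 * shift (ab.1 + 1) (gammaSum ab.2) := by
  unfold gammaSum
  simp_rw [DyckPath.gammaPoly_eq]
  rw [sum_dyckPath_succ]
  refine Finset.sum_congr rfl fun ab hab => ?_
  have hn : ab.1 + ab.2 + 1 = n + 1 := by rw [Finset.HasAntidiagonal.mem_antidiagonal.1 hab]
  simp only [stepProd_nest_add]
  simp_rw [shift]
  rw [map_sum, mul_assoc, Finset.sum_mul_sum, Finset.mul_sum]
  refine Finset.sum_congr rfl fun p _ => ?_
  rw [Finset.mul_sum]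
  refine Finset.sum_congr rfl fun q _ => ?_
  rw [p.2, q.2, hn]
  have h0 : MvPolynomial.rename (fun j => j + 0) (gammaForm (n + 1) (ab.1 + 1))
      = gammaForm (n + 1) (ab.1 + 1) := MvPolynomial.rename_id_apply _
  rw [h0, mul_assoc]
  congr 2
  unfold stepProd
  rw [map_prod]
  refine Finset.prod_congr rfl fun t _ => ?_
  rw [apply_ite (MvPolynomial.rename fun j => j + (ab.1 + 1)), map_one]
  congr 1
  exact (shift_shift _ _ _).symm

section Interlacing

open MvPolynomial

/-! ### Integration between consecutive variables -/

/-- The increasing enumeration of the natural numbers different from `j`. -/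
def skip (j k : ℕ) : ℕ := if k < j then k else k + 1

/-- The sequence `l` with the two entries `l j` and `l (j + 1)` replaced by the single entry `s`. -/
def mergeAt (j : ℕ) (l : ℕ → ℝ) (s : ℝ) (k : ℕ) : ℝ :=
  if k < j then l k else if k = j then s else l (k + 1)

theorem skip_injective (j : ℕ) : Function.Injective (skip j) := by
  intro a b h
  unfold skip at h
  split_ifs at h <;> omega

theorem skip_ne (j k : ℕ) : skip j k ≠ j := by
  unfold skip
  split_ifs <;> omega

theorem skip_of_lt {j k : ℕ} (h : k < j) : skip j k = k := if_pos h

theorem skip_of_le {j k : ℕ} (h : j ≤ k) : skip j k = k + 1 := if_neg (by omega)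

theorem mergeAt_left (j : ℕ) (l : ℕ → ℝ) : mergeAt j l (l j) = l ∘ skip (j + 1) := by
  ext k
  simp only [mergeAt, skip, Function.comp]
  split_ifs <;> first | rfl | omega | (congr 1; omega)

theorem mergeAt_right (j : ℕ) (l : ℕ → ℝ) : mergeAt j l (l (j + 1)) = l ∘ skip j := by
  ext k
  simp only [mergeAt, skip, Function.comp]
  split_ifs <;> first | rfl | omega | (congr 1; omega)

theorem exists_pderiv_eq (j : ℕ) (p : MvPolynomial ℕ ℝ) :
    ∃ P : MvPolynomial ℕ ℝ, pderiv j P = p := by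
  induction p using MvPolynomial.induction_on' with
  | monomial m a =>
    refine ⟨monomial (m + Finsupp.single j 1) (a / ((m j : ℝ) + 1)), ?_⟩
    rw [pderiv_monomial]
    have : (m j : ℝ) + 1 ≠ 0 := by positivity
    simp [this]
  | add p q hp hq =>
    obtain ⟨P, rfl⟩ := hp
    obtain ⟨Q, rfl⟩ := hq
    exact ⟨P + Q, map_add _ _ _⟩

/-- An antiderivative of `p` with respect to the variable `X j`. -/
def antideriv (j : ℕ) (p : MvPolynomial ℕ ℝ) : MvPolynomial ℕ ℝ := (exists_pderiv_eq j p).choose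

theorem pderiv_antideriv (j : ℕ) (p : MvPolynomial ℕ ℝ) : pderiv j (antideriv j p) = p :=
  (exists_pderiv_eq j p).choose_spec

theorem hasDerivAt_eval_mergeAt (j : ℕ) (l : ℕ → ℝ) (P : MvPolynomial ℕ ℝ) (s : ℝ) :
    HasDerivAt (fun s => eval (mergeAt j l s) P) (eval (mergeAt j l s) (pderiv j P)) s := by
  induction P using MvPolynomial.induction_on with
  | C a => simpa using hasDerivAt_const s a
  | add p q hp hq =>
    simp only [map_add]
    exact hp.fun_add hq
  | mul_X p i hp =>
    have hX : HasDerivAt (fun s => mergeAt j l s i) (eval (mergeAt j l s) (pderiv j (X i))) s := by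
      by_cases h : i = j
      · subst h
        simpa [mergeAt] using hasDerivAt_id' s
      · rw [pderiv_X_of_ne h]
        simpa [mergeAt, h] using hasDerivAt_const s _
    have := hp.mul hX
    simp only [eval_mul, eval_X, Derivation.leibniz, smul_eq_mul, eval_add]
    convert! this using 1
    ring

/-- The polynomial whose value at `l` is `∫ p(mergeAt j l s) ds` over `l (j + 1) ≤ s ≤ l j`. -/
def gapIntegral (j : ℕ) (p : MvPolynomial ℕ ℝ) : MvPolynomial ℕ ℝ :=
  rename (skip (j + 1)) (antideriv j p) - rename (skip j) (antideriv j p)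

theorem continuous_eval_mergeAt (j : ℕ) (l : ℕ → ℝ) (p : MvPolynomial ℕ ℝ) :
    Continuous fun s => eval (mergeAt j l s) p :=
  continuous_iff_continuousAt.2 fun s => (hasDerivAt_eval_mergeAt j l p s).continuousAt

theorem integral_eval_mergeAt (j : ℕ) (l : ℕ → ℝ) (P : MvPolynomial ℕ ℝ) :
    ∫ s in l (j + 1)..l j, eval (mergeAt j l s) (pderiv j P) =
      eval l (rename (skip (j + 1)) P - rename (skip j) P) := by
  rw [intervalIntegral.integral_eq_sub_of_hasDerivAt
    (fun s _ => hasDerivAt_eval_mergeAt j l P s)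
    ((continuous_eval_mergeAt j l _).intervalIntegrable _ _), mergeAt_left, mergeAt_right,
    eval_sub, eval_rename, eval_rename]

theorem eval_gapIntegral (j : ℕ) (l : ℕ → ℝ) (p : MvPolynomial ℕ ℝ) :
    eval l (gapIntegral j p) = ∫ s in l (j + 1)..l j, eval (mergeAt j l s) p := by
  rw [gapIntegral, ← integral_eval_mergeAt, pderiv_antideriv]

/-- The integral depends only on the integrand, so any antiderivative may replace the chosen one.
Nearly every later identity for `gapIntegral` comes from exhibiting a convenient antiderivative. -/
theorem gapIntegral_pderiv (j : ℕ) (P : MvPolynomial ℕ ℝ) :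
    gapIntegral j (pderiv j P) = rename (skip (j + 1)) P - rename (skip j) P := by
  refine MvPolynomial.funext fun l => ?_
  rw [eval_gapIntegral, integral_eval_mergeAt]

theorem gapIntegral_add (j : ℕ) (p q : MvPolynomial ℕ ℝ) :
    gapIntegral j (p + q) = gapIntegral j p + gapIntegral j q := by
  conv_lhs => rw [← pderiv_antideriv j p, ← pderiv_antideriv j q, ← map_add, gapIntegral_pderiv]
  simp only [gapIntegral, map_add]
  ring

theorem gapIntegral_sub (j : ℕ) (p q : MvPolynomial ℕ ℝ) :
    gapIntegral j (p - q) = gapIntegral j p - gapIntegral j q := by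
  rw [eq_sub_iff_add_eq, ← gapIntegral_add, sub_add_cancel]

/-! ### Derivatives of gap integrals, and integrands with a factor free of the integration variable
-/

theorem pderiv_rename_skip_self (j : ℕ) (p : MvPolynomial ℕ ℝ) :
    pderiv j (rename (skip j) p) = 0 := by
  refine pderiv_eq_zero_of_notMem_vars fun h => ?_
  obtain ⟨k, -, hk⟩ := Finset.mem_image.1 (vars_rename _ _ h)
  exact skip_ne j k hk

theorem pderiv_rename_skip_of_lt {j k : ℕ} (h : k < j) (p : MvPolynomial ℕ ℝ) :
    pderiv k (rename (skip j) p) = rename (skip j) (pderiv k p) := by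
  rw [← pderiv_rename (skip_injective j), skip_of_lt h]

theorem pderiv_succ_rename_skip_of_le {j k : ℕ} (h : j ≤ k) (p : MvPolynomial ℕ ℝ) :
    pderiv (k + 1) (rename (skip j) p) = rename (skip j) (pderiv k p) := by
  rw [← pderiv_rename (skip_injective j), skip_of_le h]

theorem pderiv_comm (i j : ℕ) (p : MvPolynomial ℕ ℝ) :
    pderiv i (pderiv j p) = pderiv j (pderiv i p) := by
  have h : ⁅(pderiv i : Derivation ℝ (MvPolynomial ℕ ℝ) (MvPolynomial ℕ ℝ)),
      (pderiv j : Derivation ℝ (MvPolynomial ℕ ℝ) (MvPolynomial ℕ ℝ))⁆ = 0 := by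
    refine MvPolynomial.derivation_ext fun k => ?_
    rw [Derivation.commutator_apply, pderiv_X, pderiv_X]
    simp only [Pi.single_apply]
    split_ifs <;> simp
  have := congrArg (fun D : Derivation ℝ (MvPolynomial ℕ ℝ) (MvPolynomial ℕ ℝ) => D p) h
  rw [Derivation.commutator_apply] at this
  exact sub_eq_zero.1 this

theorem pderiv_gapIntegral_of_lt {j k : ℕ} (h : k < j) (p : MvPolynomial ℕ ℝ) :
    pderiv k (gapIntegral j p) = gapIntegral j (pderiv k p) := by
  conv_rhs => rw [← pderiv_antideriv j p, pderiv_comm, gapIntegral_pderiv]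
  rw [gapIntegral, map_sub, pderiv_rename_skip_of_lt h, pderiv_rename_skip_of_lt (by omega)]

theorem pderiv_succ_gapIntegral_of_lt {j k : ℕ} (h : j < k) (p : MvPolynomial ℕ ℝ) :
    pderiv (k + 1) (gapIntegral j p) = gapIntegral j (pderiv k p) := by
  conv_rhs => rw [← pderiv_antideriv j p, pderiv_comm, gapIntegral_pderiv]
  rw [gapIntegral, map_sub, pderiv_succ_rename_skip_of_le h, pderiv_succ_rename_skip_of_le h.le]

theorem pderiv_gapIntegral_self (j : ℕ) (p : MvPolynomial ℕ ℝ) :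
    pderiv j (gapIntegral j p) = rename (skip (j + 1)) p := by
  rw [gapIntegral, map_sub, pderiv_rename_skip_of_lt (Nat.lt_succ_self j),
    pderiv_rename_skip_self, sub_zero, pderiv_antideriv]

theorem pderiv_succ_gapIntegral_self (j : ℕ) (p : MvPolynomial ℕ ℝ) :
    pderiv (j + 1) (gapIntegral j p) = -rename (skip j) p := by
  rw [gapIntegral, map_sub, pderiv_succ_rename_skip_of_le le_rfl,
    pderiv_rename_skip_self, zero_sub, pderiv_antideriv]

/-- The derivative in the direction of the simple root `ε_k - ε_{k+1}`. -/
def rootDeriv (k : ℕ) (p : MvPolynomial ℕ ℝ) : MvPolynomial ℕ ℝ := pderiv k p - pderiv (k + 1) p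

theorem rootDeriv_succ_gapIntegral_of_lt {j k : ℕ} (h : j < k) (p : MvPolynomial ℕ ℝ) :
    rootDeriv (k + 1) (gapIntegral j p) = gapIntegral j (rootDeriv k p) := by
  rw [rootDeriv, pderiv_succ_gapIntegral_of_lt h, pderiv_succ_gapIntegral_of_lt (by omega),
    rootDeriv, gapIntegral_sub]

theorem rootDeriv_succ_gapIntegral (k : ℕ) (p : MvPolynomial ℕ ℝ) :
    rootDeriv (k + 1) (gapIntegral k p) =
      gapIntegral k (rootDeriv k p) - rename (skip (k + 1)) p := by
  rw [rootDeriv, pderiv_succ_gapIntegral_self, pderiv_succ_gapIntegral_of_lt (by omega),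
    rootDeriv, gapIntegral_sub, gapIntegral_pderiv]
  ring

theorem rootDeriv_gapIntegral_self (k : ℕ) (p : MvPolynomial ℕ ℝ) :
    rootDeriv k (gapIntegral k p) = rename (skip (k + 1)) p + rename (skip k) p := by
  rw [rootDeriv, pderiv_gapIntegral_self, pderiv_succ_gapIntegral_self, sub_neg_eq_add]

theorem rootDeriv_gapIntegral_succ (k : ℕ) (p : MvPolynomial ℕ ℝ) :
    rootDeriv k (gapIntegral (k + 1) p) =
      gapIntegral (k + 1) (rootDeriv k p) - rename (skip (k + 1)) p := by
  rw [rootDeriv, pderiv_gapIntegral_self, pderiv_gapIntegral_of_lt (by omega),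
    rootDeriv, gapIntegral_sub, gapIntegral_pderiv]
  ring

theorem rootDeriv_gapIntegral_of_lt {j k : ℕ} (h : k + 1 < j) (p : MvPolynomial ℕ ℝ) :
    rootDeriv k (gapIntegral j p) = gapIntegral j (rootDeriv k p) := by
  rw [rootDeriv, pderiv_gapIntegral_of_lt (by omega), pderiv_gapIntegral_of_lt h,
    rootDeriv, gapIntegral_sub]

theorem rename_skip_shift {j k : ℕ} (h : j ≤ k) (p : MvPolynomial ℕ ℝ) :
    rename (skip j) (shift k p) = shift (k + 1) p := by
  simp only [shift, rename_rename]
  congr 2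
  ext i
  simp only [Function.comp, skip]
  split_ifs <;> omega

theorem rename_skip_add_shift (i k : ℕ) (p : MvPolynomial ℕ ℝ) :
    rename (skip (i + k)) (shift k p) = shift k (rename (skip i) p) := by
  simp only [shift, rename_rename]
  congr 2
  ext i
  simp only [Function.comp, skip]
  split_ifs <;> omega

theorem pderiv_add_shift (i k : ℕ) (p : MvPolynomial ℕ ℝ) :
    pderiv (i + k) (shift k p) = shift k (pderiv i p) :=
  pderiv_rename (add_left_injective k) i p

theorem pderiv_shift_of_lt {j k : ℕ} (h : j < k) (p : MvPolynomial ℕ ℝ) :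
    pderiv j (shift k p) = 0 := by
  refine pderiv_eq_zero_of_notMem_vars fun hj => ?_
  obtain ⟨i, -, hi⟩ := Finset.mem_image.1 (vars_rename _ _ hj)
  omega

theorem gapIntegral_mul_shift {j k : ℕ} (h : j < k) (p q : MvPolynomial ℕ ℝ) :
    gapIntegral j (p * shift k q) = gapIntegral j p * shift (k + 1) q := by
  have : p * shift k q = pderiv j (antideriv j p * shift k q) := by
    rw [Derivation.leibniz, pderiv_shift_of_lt h, pderiv_antideriv, smul_zero, zero_add,
      smul_eq_mul, mul_comm]
  rw [this, gapIntegral_pderiv, map_mul, map_mul, rename_skip_shift h, rename_skip_shift h.le,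
    gapIntegral]
  ring

/-- The hypothesis says that p involves no variable of index k or more, so p is constant under the
integration and comes out. -/
theorem gapIntegral_mul_shift_add {i k : ℕ} {p : MvPolynomial ℕ ℝ}
    (hp : ∀ m, k ≤ m → rename (skip m) p = p) (q : MvPolynomial ℕ ℝ) :
    gapIntegral (i + k) (p * shift k q) = p * shift k (gapIntegral i q) := by
  have h0 : pderiv (i + k) p = 0 := by
    rw [← hp (i + k) (by omega), pderiv_rename_skip_self]
  have : p * shift k q = pderiv (i + k) (p * shift k (antideriv i q)) := by
    rw [Derivation.leibniz, h0, pderiv_add_shift, pderiv_antideriv, smul_zero, add_zero,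
      smul_eq_mul]
  rw [this, gapIntegral_pderiv, map_mul, map_mul, hp _ (by omega), hp _ (by omega),
    add_right_comm, rename_skip_add_shift, rename_skip_add_shift, ← mul_sub, gapIntegral]
  simp only [shift, map_sub]

theorem gapIntegral_C_mul (j : ℕ) (c : ℝ) (p : MvPolynomial ℕ ℝ) :
    gapIntegral j (C c * p) = C c * gapIntegral j p := by
  have : C c * p = pderiv j (C c * antideriv j p) := by rw [pderiv_C_mul, pderiv_antideriv]
  rw [this, gapIntegral_pderiv, map_mul, map_mul, rename_C, rename_C, ← mul_sub, gapIntegral]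

/-! ### The polynomials defined by iterated integration over interlacing sequences -/

/-- The polynomials defined by `q_0 = 1` and
`q_{n+1}(l) = ∑_{j ≤ n} ∫ q_n(l_0, …, l_{j-1}, s, l_{j+2}, …) ds` over `l_{j+1} ≤ s ≤ l_j`. -/
def interlacePoly : ℕ → MvPolynomial ℕ ℝ
  | 0 => 1
  | n + 1 => ∑ j ∈ Finset.range (n + 1), gapIntegral j (interlacePoly n)

theorem eval_interlacePoly_congr (n : ℕ) {l l' : ℕ → ℝ} (h : ∀ k ≤ n, l k = l' k) :
    eval l (interlacePoly n) = eval l' (interlacePoly n) := by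
  induction n generalizing l l' with
  | zero => simp [interlacePoly]
  | succ n ih =>
    simp only [interlacePoly, map_sum]
    refine Finset.sum_congr rfl fun j hj => ?_
    rw [Finset.mem_range] at hj
    rw [eval_gapIntegral, eval_gapIntegral, h j (by omega), h (j + 1) (by omega)]
    congr 1
    ext s
    refine ih fun k hk => ?_
    rw [mergeAt, mergeAt, h k (by omega), h (k + 1) (by omega)]

theorem rename_interlacePoly_congr (n : ℕ) {f g : ℕ → ℕ} (h : ∀ k ≤ n, f k = g k) :
    rename f (interlacePoly n) = rename g (interlacePoly n) := by
  refine MvPolynomial.funext fun l => ?_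
  rw [eval_rename, eval_rename]
  exact eval_interlacePoly_congr n fun k hk => by rw [Function.comp, h k hk, Function.comp]

theorem rename_skip_interlacePoly {n m : ℕ} (h : n < m) :
    rename (skip m) (interlacePoly n) = interlacePoly n := by
  rw [rename_interlacePoly_congr n (f := skip m) (g := id) fun k hk => skip_of_lt (by omega),
    rename_id_apply]

theorem vars_interlacePoly (n : ℕ) : (interlacePoly n).vars ⊆ Finset.range (n + 1) := by
  intro k hk
  -- Renaming by k ↦ min k n leaves the polynomial unchanged, and the new indices are visibly at
  -- most n.
  rw [← rename_id_apply (interlacePoly n), ← rename_interlacePoly_congr n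
    (f := fun k => min k n) (g := id) fun k hk => min_eq_left hk] at hk
  obtain ⟨i, -, rfl⟩ := Finset.mem_image.1 (vars_rename _ _ hk)
  rw [Finset.mem_range]
  omega

/-- Induction over the summands of `interlacePoly`. The root derivative commutes with the integral
over the gap j except for j = k - 1, k, k + 1. The gap k yields two boundary terms, each cancelling
the one from a neighbouring gap when that gap exists. The gaps below k then rebuild the left factor
with coefficient binom(N+2, k), those above k the right factor with binom(N+2, k+1), and Pascal's
rule adds them. -/
theorem rootDeriv_interlacePoly (N k b : ℕ) (h : N = k + b) :
    rootDeriv k (interlacePoly (N + 1)) = C (((N + 2).choose (k + 1) : ℕ) : ℝ) *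
      (interlacePoly k * shift (k + 1) (interlacePoly b)) := by
  induction N generalizing k b with
  | zero =>
    obtain ⟨rfl, rfl⟩ : k = 0 ∧ b = 0 := by omega
    simp only [interlacePoly, zero_add, Finset.sum_range_one]
    rw [rootDeriv_gapIntegral_self, map_one, map_one, shift, map_one]
    norm_num
    exact (map_ofNat C 2).symm
  | succ N ih =>
    have hsum : rootDeriv k (interlacePoly (N + 1 + 1)) =
        ∑ j ∈ Finset.range (k + (b + 1)), rootDeriv k (gapIntegral j (interlacePoly (N + 1))) := by
      rw [interlacePoly, h, rootDeriv, map_sum, map_sum, ← Finset.sum_sub_distrib]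
      rfl
    have hA : ∑ j ∈ Finset.range k, rootDeriv k (gapIntegral j (interlacePoly (N + 1))) +
        rename (skip k) (interlacePoly (N + 1)) = C (((N + 2).choose k : ℕ) : ℝ) *
          (interlacePoly k * shift (k + 1) (interlacePoly b)) := by
      cases k with
      | zero =>
        -- No gap lies below k = 0; the leftover boundary term is itself the product, as skipping 0
        -- is the shift by 1.
        have hb : b = N + 1 := by omega
        subst hb
        simp only [Finset.range_zero, Finset.sum_empty, zero_add, Nat.choose_zero_right,
          Nat.cast_one, C_1, one_mul, interlacePoly, shift]
        congr 1
      | succ k =>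
        rw [Finset.sum_range_succ, rootDeriv_succ_gapIntegral, ih k b (by omega),
          Finset.sum_congr rfl fun j hj => by
            rw [rootDeriv_succ_gapIntegral_of_lt (Finset.mem_range.1 hj), ih k b (by omega)],
          ← add_sub_assoc, sub_add_cancel]
        rw [← Finset.sum_range_succ fun j => gapIntegral j (C (((N + 2).choose (k + 1) : ℕ) : ℝ) *
          (interlacePoly k * shift (k + 1) (interlacePoly b)))]
        rw [Finset.sum_congr rfl fun j hj => by
          rw [gapIntegral_C_mul, gapIntegral_mul_shift (Finset.mem_range.1 hj)]]
        rw [← Finset.mul_sum, ← Finset.sum_mul]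
        rfl
    have hB : ∑ i ∈ Finset.range b,
          rootDeriv k (gapIntegral (k + (i + 1)) (interlacePoly (N + 1))) +
        rename (skip (k + 1)) (interlacePoly (N + 1)) = C (((N + 2).choose (k + 1) : ℕ) : ℝ) *
          (interlacePoly k * shift (k + 1) (interlacePoly b)) := by
      cases b with
      | zero =>
        have hk : k = N + 1 := by omega
        subst hk
        rw [rename_skip_interlacePoly (by omega)]
        simp [interlacePoly, shift]
      | succ b =>
        have hk : ∀ m, k + 1 ≤ m → rename (skip m) (interlacePoly k) = interlacePoly k :=
          fun m hm => rename_skip_interlacePoly (by omega)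
        rw [Finset.sum_range_succ', zero_add, rootDeriv_gapIntegral_succ, ih k b (by omega),
          Finset.sum_congr rfl fun j hj => by
            rw [rootDeriv_gapIntegral_of_lt (by omega), ih k b (by omega)],
          ← add_sub_assoc, sub_add_cancel]
        have h1 := Finset.sum_range_succ' (fun j => gapIntegral (k + (j + 1))
          (C (((N + 2).choose (k + 1) : ℕ) : ℝ) *
            (interlacePoly k * shift (k + 1) (interlacePoly b)))) b
        rw [zero_add] at h1
        rw [← h1, Finset.sum_congr rfl fun j hj => by
          rw [gapIntegral_C_mul, show k + (j + 1) = j + (k + 1) by omega,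
            gapIntegral_mul_shift_add hk]]
        rw [← Finset.mul_sum, ← Finset.mul_sum]
        simp only [shift, ← map_sum]
        rfl
    rw [hsum, Finset.sum_range_add, Finset.sum_range_succ', add_zero, rootDeriv_gapIntegral_self]
    rw [Nat.choose_succ_succ (N + 2) k, Nat.cast_add, C_add, add_mul, ← hA]
    rw [← hB]
    ring

end Interlacing

section Recursion

open MvPolynomial

/-! ### Homogeneity, translation invariance and the recursion -/

/-- The Euler derivation `∑ X_i ∂_i`. -/
def eulerDeriv : Derivation ℝ (MvPolynomial ℕ ℝ) (MvPolynomial ℕ ℝ) := mkDerivation ℝ X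

/-- The derivation `∑ ∂_i` in the direction of the diagonal. -/
def diagDeriv : Derivation ℝ (MvPolynomial ℕ ℝ) (MvPolynomial ℕ ℝ) := mkDerivation ℝ fun _ => 1

theorem eulerDeriv_rename (f : ℕ → ℕ) (p : MvPolynomial ℕ ℝ) :
    eulerDeriv (rename f p) = rename f (eulerDeriv p) := by
  induction p using MvPolynomial.induction_on with
  | C a => simp [eulerDeriv]
  | add p q hp hq => simp [hp, hq]
  | mul_X p i hp =>
    simp only [map_mul, rename_X, Derivation.leibniz, hp, smul_eq_mul, map_add]
    simp [eulerDeriv, mkDerivation_X]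

theorem diagDeriv_rename (f : ℕ → ℕ) (p : MvPolynomial ℕ ℝ) :
    diagDeriv (rename f p) = rename f (diagDeriv p) := by
  induction p using MvPolynomial.induction_on with
  | C a => simp [diagDeriv]
  | add p q hp hq => simp [hp, hq]
  | mul_X p i hp =>
    simp only [map_mul, rename_X, Derivation.leibniz, hp, smul_eq_mul, map_add]
    simp [diagDeriv, mkDerivation_X]

theorem pderiv_eulerDeriv (j : ℕ) (p : MvPolynomial ℕ ℝ) :
    pderiv j (eulerDeriv p) = eulerDeriv (pderiv j p) + pderiv j p := by
  have h : ⁅(pderiv j : Derivation ℝ (MvPolynomial ℕ ℝ) (MvPolynomial ℕ ℝ)), eulerDeriv⁆ =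
      pderiv j := by
    refine MvPolynomial.derivation_ext fun k => ?_
    rw [Derivation.commutator_apply, eulerDeriv, mkDerivation_X, pderiv_X]
    simp only [Pi.single_apply]
    split_ifs <;> simp
  have := congrArg (fun D : Derivation ℝ (MvPolynomial ℕ ℝ) (MvPolynomial ℕ ℝ) => D p) h
  rw [Derivation.commutator_apply] at this
  exact sub_eq_iff_eq_add'.1 this

theorem pderiv_diagDeriv (j : ℕ) (p : MvPolynomial ℕ ℝ) :
    pderiv j (diagDeriv p) = diagDeriv (pderiv j p) := by
  have h : ⁅(pderiv j : Derivation ℝ (MvPolynomial ℕ ℝ) (MvPolynomial ℕ ℝ)), diagDeriv⁆ = 0 := by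
    refine MvPolynomial.derivation_ext fun k => ?_
    rw [Derivation.commutator_apply, diagDeriv, mkDerivation_X, pderiv_X]
    simp only [Pi.single_apply]
    split_ifs <;> simp
  have := congrArg (fun D : Derivation ℝ (MvPolynomial ℕ ℝ) (MvPolynomial ℕ ℝ) => D p) h
  rw [Derivation.commutator_apply] at this
  exact sub_eq_zero.1 this

theorem eulerDeriv_gapIntegral (j : ℕ) (p : MvPolynomial ℕ ℝ) :
    eulerDeriv (gapIntegral j p) = gapIntegral j (eulerDeriv p) + gapIntegral j p := by
  rw [← gapIntegral_add]
  conv_rhs => rw [← pderiv_antideriv j p, ← pderiv_eulerDeriv, gapIntegral_pderiv]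
  rw [gapIntegral, map_sub, eulerDeriv_rename, eulerDeriv_rename]

theorem diagDeriv_gapIntegral (j : ℕ) (p : MvPolynomial ℕ ℝ) :
    diagDeriv (gapIntegral j p) = gapIntegral j (diagDeriv p) := by
  conv_rhs => rw [← pderiv_antideriv j p, ← pderiv_diagDeriv, gapIntegral_pderiv]
  rw [gapIntegral, map_sub, diagDeriv_rename, diagDeriv_rename]

theorem eulerDeriv_interlacePoly (n : ℕ) :
    eulerDeriv (interlacePoly n) = C (n : ℝ) * interlacePoly n := by
  induction n with
  | zero => simp [interlacePoly]
  | succ n ih =>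
    rw [interlacePoly, map_sum, Finset.mul_sum]
    refine Finset.sum_congr rfl fun j _ => ?_
    rw [eulerDeriv_gapIntegral, ih, gapIntegral_C_mul, Nat.cast_succ, C_add, C_1, add_mul, one_mul]

theorem diagDeriv_interlacePoly (n : ℕ) : diagDeriv (interlacePoly n) = 0 := by
  induction n with
  | zero => simp [interlacePoly]
  | succ n ih =>
    rw [interlacePoly, map_sum]
    refine Finset.sum_eq_zero fun j _ => ?_
    rw [diagDeriv_gapIntegral, ih]
    simpa using gapIntegral_C_mul j 0 0

theorem mkDerivation_eq_sum {p : MvPolynomial ℕ ℝ} {s : Finset ℕ} (hp : p.vars ⊆ s)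
    (f : ℕ → MvPolynomial ℕ ℝ) : mkDerivation ℝ f p = ∑ k ∈ s, f k * pderiv k p := by
  have hs : ∀ q, (∑ k ∈ s, f k • (pderiv k : Derivation ℝ (MvPolynomial ℕ ℝ) (MvPolynomial ℕ ℝ))) q
      = ∑ k ∈ s, f k * pderiv k q := fun q => by
    rw [← Derivation.coeFnAddMonoidHom_apply, map_sum, Finset.sum_apply]
    rfl
  rw [← hs]
  refine derivation_eq_of_forall_mem_vars fun i hi => ?_
  rw [mkDerivation_X, hs, Finset.sum_eq_single i]
  · simp
  · intro b _ hb
    simp [pderiv_X_of_ne hb.symm]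
  · intro h
    exact absurd (hp hi) h

/-- Abel summation; it serves for Euler's identity, for the Cartan coefficients and for Rado's
theorem. -/
theorem sum_mul_eq_sum_partialSums (l d : ℕ → ℝ) (m : ℕ) :
    ∑ k ∈ Finset.range (m + 1), l k * d k =
      ∑ i ∈ Finset.range m, (∑ k ∈ Finset.range (i + 1), l k) * (d i - d (i + 1)) +
        (∑ k ∈ Finset.range (m + 1), l k) * d m := by
  induction m with
  | zero => simp
  | succ m ih =>
    rw [Finset.sum_range_succ, ih, Finset.sum_range_succ
      (fun i => (∑ k ∈ Finset.range (i + 1), l k) * (d i - d (i + 1))) m,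
      Finset.sum_range_succ l (m + 1)]
    ring

theorem eval_interlacePoly_succ (n : ℕ) (l : ℕ → ℝ) :
    ((n : ℝ) + 1) * eval l (interlacePoly (n + 1)) =
      ∑ i ∈ Finset.range (n + 1), (∑ k ∈ Finset.range (i + 1), l k -
          ((i : ℝ) + 1) / ((n : ℝ) + 2) * ∑ k ∈ Finset.range (n + 2), l k) *
        (((n + 2).choose (i + 1) : ℕ) * (eval l (interlacePoly i) *
          eval (fun k => l (k + (i + 1))) (interlacePoly (n - i)))) := by
  have hE := congrArg (eval l) (eulerDeriv_interlacePoly (n + 1))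
  have hT := congrArg (eval l) (diagDeriv_interlacePoly (n + 1))
  rw [eulerDeriv, mkDerivation_eq_sum (vars_interlacePoly _), map_sum] at hE
  rw [diagDeriv, mkDerivation_eq_sum (vars_interlacePoly _), map_sum] at hT
  simp only [eval_mul, eval_X, eval_C, map_one, map_zero] at hE hT
  rw [sum_mul_eq_sum_partialSums] at hE
  rw [sum_mul_eq_sum_partialSums] at hT
  have hg : ∀ i ∈ Finset.range (n + 1),
      eval l (pderiv i (interlacePoly (n + 1))) - eval l (pderiv (i + 1) (interlacePoly (n + 1))) =
        ((n + 2).choose (i + 1) : ℕ) * (eval l (interlacePoly i) *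
          eval (fun k => l (k + (i + 1))) (interlacePoly (n - i))) := by
    intro i hi
    rw [Finset.mem_range] at hi
    have := congrArg (eval l) (rootDeriv_interlacePoly n i (n - i) (by omega))
    rw [rootDeriv, eval_sub] at this
    rw [this, eval_mul, eval_mul, eval_C, shift, eval_rename]
    rfl
  rw [Finset.sum_congr rfl fun i hi => by rw [hg i hi]] at hE hT
  simp only [Finset.sum_const, Finset.card_range, nsmul_eq_mul, mul_one] at hT
  simp_rw [sub_mul]
  rw [Finset.sum_sub_distrib]
  push_cast at *
  rw [← hE]
  have h2 : (n : ℝ) + 2 ≠ 0 := by positivity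
  -- Abel summation leaves the last partial derivative over; translation invariance expresses it by
  -- root derivatives, which subtracts the mean from the partial sums.
  have hT' : eval l (pderiv (n + 1) (interlacePoly (n + 1))) =
      -∑ i ∈ Finset.range (n + 1), ((i : ℝ) + 1) / ((n : ℝ) + 2) *
        (((n + 2).choose (i + 1) : ℕ) * (eval l (interlacePoly i) *
          eval (fun k => l (k + (i + 1))) (interlacePoly (n - i)))) := by
    simp_rw [div_mul_eq_mul_div]
    rw [← Finset.sum_div, ← neg_div, eq_div_iff h2]
    linear_combination hT
  rw [hT', sub_eq_add_neg, mul_neg, Finset.mul_sum]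
  congr 2
  refine Finset.sum_congr rfl fun i _ => ?_
  ring

/-- Both sides pair l with the fundamental weight of index i + 1: its coordinates have the Cartan
entries as partial sums, and their total vanishes. -/
theorem sum_cartanInv_mul (n i : ℕ) (hi : i ≤ n) (l : ℕ → ℝ) :
    ∑ j ∈ Finset.range (n + 1), cartanInv (n + 1) (i + 1) (j + 1) * (l j - l (j + 1)) =
      ∑ k ∈ Finset.range (i + 1), l k -
        ((i : ℝ) + 1) / ((n : ℝ) + 2) * ∑ k ∈ Finset.range (n + 2), l k := by
  have h2 : (n : ℝ) + 2 ≠ 0 := by positivity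
  have hps : ∀ m, ∑ k ∈ Finset.range m,
      ((if k < i + 1 then 1 else 0) - ((i : ℝ) + 1) / ((n : ℝ) + 2)) =
        cartanInv (n + 1) (i + 1) m := by
    intro m
    rw [Finset.sum_sub_distrib, Finset.sum_boole, Finset.sum_const, Finset.card_range,
      cartanInv]
    have : (Finset.range m).filter (· < i + 1) = Finset.range (min (i + 1) m) := by
      ext k; simp; omega
    rw [this, Finset.card_range]
    push_cast
    rw [nsmul_eq_mul, show (n : ℝ) + 1 + 1 = n + 2 by ring]
    ring
  have h0 : cartanInv (n + 1) (i + 1) (n + 2) = 0 := by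
    rw [cartanInv, min_eq_left (by omega)]
    push_cast
    rw [show (n : ℝ) + 1 + 1 = n + 2 by ring]
    field_simp
    ring
  have := sum_mul_eq_sum_partialSums
    (fun k => (if k < i + 1 then 1 else 0) - ((i : ℝ) + 1) / ((n : ℝ) + 2)) l (n + 1)
  simp only [hps, h0, zero_mul, add_zero] at this
  rw [← this]
  simp_rw [sub_mul, ite_mul, one_mul, zero_mul]
  rw [Finset.sum_sub_distrib, ← Finset.mul_sum, ← Finset.sum_filter]
  congr 2
  ext k
  simp
  omega

theorem eval_interlacePoly_eq_eval_gammaSum (n : ℕ) (l x : ℕ → ℝ)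
    (h : ∀ k, x (k + 1) = l k - l (k + 1)) :
    eval l (interlacePoly n) = eval x (gammaSum n) := by
  induction n using Nat.strong_induction_on generalizing l x with
  | _ n ih =>
  cases n with
  | zero => simp [interlacePoly, gammaSum_zero]
  | succ n =>
    have hn : (n : ℝ) + 1 ≠ 0 := by positivity
    refine mul_left_cancel₀ hn ?_
    rw [eval_interlacePoly_succ, gammaSum_succ, map_sum, Finset.mul_sum,
      Finset.Nat.sum_antidiagonal_eq_sum_range_succ_mk]
    refine Finset.sum_congr rfl fun i hi => ?_
    rw [Finset.mem_range] at hi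
    rw [← sum_cartanInv_mul n i (by omega), ih i (by omega) l x h,
      ih (n - i) (by omega) (fun k => l (k + (i + 1))) (fun k => x (k + (i + 1)))
        fun k => by rw [add_right_comm, h, add_right_comm]]
    rw [eval_mul, eval_mul, shift, eval_rename, gammaForm, eval_mul, eval_C, map_sum]
    simp only [eval_mul, eval_C, eval_X]
    have hIcc : Finset.Icc 1 (n + 1) = Finset.Ico 1 (n + 2) := by ext; simp; omega
    rw [hIcc, Finset.sum_Ico_eq_sum_range, show n + 2 - 1 = n + 1 by omega]
    simp_rw [add_comm 1, h]
    push_cast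
    field_simp
    congr 2

end Recursion

section Volume

open MvPolynomial

/-! ### The permutohedron in coordinates, and its volume -/

/-- The sum of the first `k` entries of `l`. -/
def partialSum (l : ℕ → ℝ) (k : ℕ) : ℝ := ∑ i ∈ Finset.range k, l i

theorem partialSum_succ (l : ℕ → ℝ) (k : ℕ) : partialSum l (k + 1) = partialSum l k + l k :=
  Finset.sum_range_succ _ _

/-- The projection to the first `n` coordinates of the set of all `v ∈ ℝ^{n+1}` majorized by
`(l 0, …, l n)`. -/
def projPermutohedron (n : ℕ) (l : ℕ → ℝ) : Set (Fin n → ℝ) :=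
  {w | ∀ S : Finset (Fin n), partialSum l (n + 1) - partialSum l (n + 1 - S.card) ≤ ∑ i ∈ S, w i ∧
    ∑ i ∈ S, w i ≤ partialSum l S.card}

theorem isClosed_projPermutohedron (n : ℕ) (l : ℕ → ℝ) : IsClosed (projPermutohedron n l) := by
  simp only [projPermutohedron, Set.ofPred_forall, Set.ofPred_and]
  refine isClosed_iInter fun S => IsClosed.inter ?_ ?_
  · exact isClosed_le continuous_const (by fun_prop)
  · exact isClosed_le (by fun_prop) continuous_const

theorem forall_finset_fin_succ {n : ℕ} {P : Finset (Fin (n + 1)) → Prop} :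
    (∀ S, P S) ↔ ∀ S : Finset (Fin n), P (S.map (Fin.succEmb n)) ∧
      P (Finset.cons 0 (S.map (Fin.succEmb n)) (by simp)) := by
  refine ⟨fun h S => ⟨h _, h _⟩, fun h S => ?_⟩
  have hS : ∀ i : Fin n, i.succ ∈ S ↔
      i ∈ Finset.univ.filter fun i : Fin n => i.succ ∈ S := by simp
  by_cases h0 : (0 : Fin (n + 1)) ∈ S
  · convert (h (Finset.univ.filter fun i : Fin n => i.succ ∈ S)).2
    ext i
    refine Fin.cases ?_ (fun i => ?_) i
    · simp [h0]
    · simp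
  · convert (h (Finset.univ.filter fun i : Fin n => i.succ ∈ S)).1
    ext i
    refine Fin.cases ?_ (fun i => ?_) i
    · simp [h0]
    · simp

theorem partialSum_mergeAt (j : ℕ) (l : ℕ → ℝ) (t : ℝ) (k : ℕ) :
    partialSum (mergeAt j l (l j + l (j + 1) - t)) k =
      if k ≤ j then partialSum l k else partialSum l (k + 1) - t := by
  induction k with
  | zero => simp [partialSum]
  | succ k ih =>
    rw [partialSum_succ, ih, mergeAt]
    rcases lt_trichotomy k j with h | h | h
    · rw [if_pos (by omega), if_pos h, if_pos (by omega), partialSum_succ]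
    · subst h
      rw [if_pos le_rfl, if_neg (by omega), if_pos rfl, if_neg (by omega), partialSum_succ,
        partialSum_succ]
      ring
    · rw [if_neg (by omega), if_neg (by omega), if_neg (by omega), if_neg (by omega),
        partialSum_succ l (k + 1)]
      ring

/-- Each S bounds the sum of w over S from above twice, without and with the new coordinate: by P(k)
and by P(k+1) - t, where k = |S| and P is `partialSum l`. As l_{j+1} ≤ t ≤ l_j, the first is the
stronger for k ≤ j and the second for k > j, which is exactly the partial sum of the merged
sequence. Lower bounds behave in the same way with m = n + 1 - |S|. -/
theorem cons_mem_projPermutohedron {n j : ℕ} (hj : j ≤ n) {l : ℕ → ℝ}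
    (hl : AntitoneOn l (Set.Iic (n + 1))) {t : ℝ} (h1 : l (j + 1) ≤ t) (h2 : t ≤ l j)
    (w : Fin n → ℝ) :
    (Fin.cons t w : Fin (n + 1) → ℝ) ∈ projPermutohedron (n + 1) l ↔
      w ∈ projPermutohedron n (mergeAt j l (l j + l (j + 1) - t)) := by
  simp only [projPermutohedron, Set.mem_ofPred_eq]
  rw [forall_finset_fin_succ]
  refine forall_congr' fun S => ?_
  simp only [Finset.sum_map, Finset.sum_cons, Finset.card_map, Finset.card_cons, Fin.coe_succEmb,
    Fin.cons_succ, Fin.cons_zero, partialSum_mergeAt]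
  have hS : S.card ≤ n := by simpa using S.card_le_univ
  obtain ⟨m, hm⟩ : ∃ m, n + 1 = m + S.card := ⟨n + 1 - S.card, by omega⟩
  rw [show n + 1 + 1 - S.card = m + 1 by omega, show n + 1 + 1 - (S.card + 1) = m by omega,
    show n + 1 - S.card = m by omega, if_neg (show ¬ n + 1 ≤ j by omega)]
  have key1 : ∀ k ≤ j, partialSum l k ≤ partialSum l (k + 1) - t := fun k hk => by
    rw [partialSum_succ]
    have := hl (Set.mem_Iic.2 (by omega)) (Set.mem_Iic.2 (show j ≤ n + 1 by omega)) hk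
    linarith
  have key2 : ∀ k ≤ n + 1, ¬ k ≤ j → partialSum l (k + 1) - t ≤ partialSum l k :=
    fun k hk hkj => by
      rw [partialSum_succ]
      have := hl (Set.mem_Iic.2 (show j + 1 ≤ n + 1 by omega)) (Set.mem_Iic.2 hk) (by omega)
      linarith
  by_cases hk : S.card ≤ j <;> by_cases hmj : m ≤ j
  · have := key1 _ hk
    have := key1 _ hmj
    simp only [hk, hmj, if_true]
    constructor
    · rintro ⟨⟨_, _⟩, _, _⟩
      constructor <;> linarith
    · rintro ⟨_, _⟩
      refine ⟨⟨?_, ?_⟩, ?_, ?_⟩ <;> linarith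
  · have := key1 _ hk
    have := key2 m (by omega) hmj
    simp only [hk, hmj, if_true, if_false]
    constructor
    · rintro ⟨⟨_, _⟩, _, _⟩
      constructor <;> linarith
    · rintro ⟨_, _⟩
      refine ⟨⟨?_, ?_⟩, ?_, ?_⟩ <;> linarith
  · have := key2 _ (by omega) hk
    have := key1 _ hmj
    simp only [hk, hmj, if_true, if_false]
    constructor
    · rintro ⟨⟨_, _⟩, _, _⟩
      constructor <;> linarith
    · rintro ⟨_, _⟩
      refine ⟨⟨?_, ?_⟩, ?_, ?_⟩ <;> linarith
  · have := key2 _ (by omega) hk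
    have := key2 m (by omega) hmj
    simp only [hk, hmj, if_false]
    constructor
    · rintro ⟨⟨_, _⟩, _, _⟩
      constructor <;> linarith
    · rintro ⟨_, _⟩
      refine ⟨⟨?_, ?_⟩, ?_, ?_⟩ <;> linarith

theorem mem_Icc_of_cons_mem_projPermutohedron {n : ℕ} {l : ℕ → ℝ} {t : ℝ} {w : Fin n → ℝ}
    (h : (Fin.cons t w : Fin (n + 1) → ℝ) ∈ projPermutohedron (n + 1) l) :
    t ∈ Set.Icc (l (n + 1)) (l 0) := by
  have := h {0}
  simp only [Finset.card_singleton, Finset.sum_singleton, Fin.cons_zero, Nat.add_sub_cancel] at this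
  rw [partialSum_succ l (n + 1)] at this
  have h1 : partialSum l 1 = l 0 := by simp [partialSum]
  rw [h1] at this
  exact ⟨by linarith, this.2⟩

theorem antitoneOn_mergeAt {n j : ℕ} (hj : j ≤ n) {l : ℕ → ℝ}
    (hl : AntitoneOn l (Set.Iic (n + 1))) {s : ℝ} (h1 : l (j + 1) ≤ s) (h2 : s ≤ l j) :
    AntitoneOn (mergeAt j l s) (Set.Iic n) := by
  intro a ha b hb hab
  rw [Set.mem_Iic] at ha hb
  have key : ∀ c d, c ≤ d → d ≤ n + 1 → l d ≤ l c := fun c d hcd hd =>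
    hl (Set.mem_Iic.2 (hcd.trans hd)) (Set.mem_Iic.2 hd) hcd
  unfold mergeAt
  split_ifs with c1 c2 c3 c4 c5 c6 <;>
    first
    | omega
    | exact le_rfl
    | exact key _ _ (by omega) (by omega)
    | exact h2.trans (key _ _ (by omega) (by omega))
    | exact (key (j + 1) _ (by omega) (by omega)).trans h1

theorem lintegral_Ioc_eq_sum {l : ℕ → ℝ} {m : ℕ} (hl : AntitoneOn l (Set.Iic m))
    (g : ℝ → ENNReal) : ∫⁻ t in Set.Ioc (l m) (l 0), g t =
      ∑ j ∈ Finset.range m, ∫⁻ t in Set.Ioc (l (j + 1)) (l j), g t := by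
  induction m with
  | zero => simp
  | succ m ih =>
    rw [Finset.sum_range_succ, ← ih (hl.mono (Set.Iic_subset_Iic.2 (by omega))),
      ← lintegral_union measurableSet_Ioc, Set.union_comm, Set.Ioc_union_Ioc_eq_Ioc]
    · exact hl (Set.mem_Iic.2 (by omega)) (Set.mem_Iic.2 le_rfl) (by omega)
    · exact hl (Set.mem_Iic.2 (by omega)) (Set.mem_Iic.2 (by omega)) (by omega)
    · exact Set.disjoint_left.2 fun t ht ht' => absurd ht'.2 (not_le.2 ht.1)

theorem volume_eq_lintegral_cons {n : ℕ} {s : Set (Fin (n + 1) → ℝ)} (hs : MeasurableSet s) :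
    volume s = ∫⁻ t, volume {w : Fin n → ℝ | (Fin.cons t w : Fin (n + 1) → ℝ) ∈ s} := by
  have hmp := (volume_preserving_piFinSuccAbove (fun _ : Fin (n + 1) => ℝ) 0).symm
  rw [← hmp.measure_preimage hs.nullMeasurableSet, Measure.volume_eq_prod,
    Measure.prod_apply (hmp.measurable hs)]
  refine lintegral_congr fun t => ?_
  congr 1
  ext w
  change (Fin.insertNth 0 t w : Fin (n + 1) → ℝ) ∈ s ↔ _
  rw [Fin.insertNth_zero']
  rfl

theorem volume_projPermutohedron (n : ℕ) {l : ℕ → ℝ} (hl : AntitoneOn l (Set.Iic n)) :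
    volume (projPermutohedron n l) = ENNReal.ofReal (eval l (interlacePoly n)) ∧
      0 ≤ eval l (interlacePoly n) := by
  induction n generalizing l with
  | zero =>
    have : projPermutohedron 0 l = Set.univ := by
      ext w
      simp [projPermutohedron, partialSum, Finset.eq_empty_of_isEmpty]
    rw [this]
    simp [interlacePoly, volume_pi]
  | succ n ih =>
    have hle : ∀ j ≤ n, l (j + 1) ≤ l j := fun j hj =>
      hl (Set.mem_Iic.2 (by omega)) (Set.mem_Iic.2 (by omega)) (by omega)
    have hnn : ∀ j ≤ n, ∀ s ∈ Set.Icc (l (j + 1)) (l j),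
        0 ≤ eval (mergeAt j l s) (interlacePoly n) := fun j hj s hs =>
      (ih (antitoneOn_mergeAt hj hl hs.1 hs.2)).2
    have hgap : ∀ j ≤ n, 0 ≤ eval l (gapIntegral j (interlacePoly n)) := fun j hj => by
      rw [eval_gapIntegral]
      exact intervalIntegral.integral_nonneg (hle j hj) (hnn j hj)
    -- A slice at t has the merged entry l_j + l_{j+1} - t; this reflection maps the gap to itself,
    -- so the integral over t equals the one over the merged entry.
    have hflip : ∀ j, ∀ t ∈ Set.Ioc (l (j + 1)) (l j),
        l j + l (j + 1) - t ∈ Set.Icc (l (j + 1)) (l j) := fun j t ht =>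
      ⟨by linarith [ht.2], by linarith [ht.1]⟩
    have hpiece : ∀ j ≤ n, ∫⁻ t in Set.Ioc (l (j + 1)) (l j),
        volume {w : Fin n → ℝ | (Fin.cons t w : Fin (n + 1) → ℝ) ∈ projPermutohedron (n + 1) l} =
          ENNReal.ofReal (eval l (gapIntegral j (interlacePoly n))) := by
      intro j hj
      have h1 : ∀ t ∈ Set.Ioc (l (j + 1)) (l j),
          volume {w : Fin n → ℝ |
            (Fin.cons t w : Fin (n + 1) → ℝ) ∈ projPermutohedron (n + 1) l} =
          ENNReal.ofReal (eval (mergeAt j l (l j + l (j + 1) - t)) (interlacePoly n)) := by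
        intro t ht
        rw [← (ih (antitoneOn_mergeAt hj hl (hflip j t ht).1 (hflip j t ht).2)).1]
        congr 1
        ext w
        exact cons_mem_projPermutohedron hj hl ht.1.le ht.2 w
      have hcont : Continuous fun t : ℝ =>
          eval (mergeAt j l (l j + l (j + 1) - t)) (interlacePoly n) :=
        (continuous_eval_mergeAt j l _).comp (continuous_const.sub continuous_id)
      rw [setLIntegral_congr_fun measurableSet_Ioc h1, ← ofReal_integral_eq_lintegral_ofReal,
        ← intervalIntegral.integral_of_le (hle j hj),
        intervalIntegral.integral_comp_sub_left
          (fun s => eval (mergeAt j l s) (interlacePoly n)), eval_gapIntegral]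
      · congr 2 <;> ring
      · exact (hcont.integrableOn_Icc (a := l (j + 1)) (b := l j)).mono_set Set.Ioc_subset_Icc_self
      · refine (ae_restrict_iff' measurableSet_Ioc).2 (Filter.Eventually.of_forall fun t ht => ?_)
        exact hnn j hj _ (hflip j t ht)
    refine ⟨?_, ?_⟩
    · rw [volume_eq_lintegral_cons (isClosed_projPermutohedron _ _).measurableSet,
        ← setLIntegral_eq_of_support_subset (s := Set.Icc (l (n + 1)) (l 0)),
        setLIntegral_congr (Ioc_ae_eq_Icc (α := ℝ)).symm, lintegral_Ioc_eq_sum hl, interlacePoly,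
        map_sum, ENNReal.ofReal_sum_of_nonneg]
      · exact Finset.sum_congr rfl fun j hj => hpiece j (by rw [Finset.mem_range] at hj; omega)
      · exact fun j hj => hgap j (by rw [Finset.mem_range] at hj; omega)
      · intro t ht
        by_contra h
        refine ht ?_
        convert measure_empty (μ := (volume : Measure (Fin n → ℝ)))
        refine Set.eq_empty_of_forall_notMem fun w hw => h ?_
        exact mem_Icc_of_cons_mem_projPermutohedron hw
    · rw [interlacePoly, map_sum]
      exact Finset.sum_nonneg fun j hj => hgap j (by rw [Finset.mem_range] at hj; omega)

end Volume

/-! ### The permutohedron is cut out by the majorization inequalities -/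

theorem sum_le_partialSum {n : ℕ} {l : ℕ → ℝ} (hl : AntitoneOn l (Set.Iic n))
    (S : Finset (Fin (n + 1))) : ∑ i ∈ S, l i ≤ partialSum l S.card := by
  induction S using Finset.induction_on_max with
  | empty => simp [partialSum]
  | insert a S ha ih =>
    have haS : a ∉ S := fun h => lt_irrefl _ (ha a h)
    rw [Finset.sum_insert haS, Finset.card_insert_of_notMem haS, partialSum_succ, add_comm]
    -- The largest index a is at least the number of smaller ones, so l_a is at most the next term
    -- of the partial sum.
    have hcard : S.card ≤ a := by
      have : S ⊆ Finset.Iio a := fun i hi => Finset.mem_Iio.2 (ha i hi)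
      simpa using Finset.card_le_card this
    have ha' : (a : ℕ) ≤ n := by omega
    exact add_le_add ih (hl (Set.mem_Iic.2 (hcard.trans ha')) (Set.mem_Iic.2 ha') hcard)

theorem partialSum_eq_sum_fin (l : ℕ → ℝ) (n : ℕ) : partialSum l n = ∑ i : Fin n, l i :=
  (Fin.sum_univ_eq_sum_range l n).symm

theorem sum_mul_le_sum_mul_of_partialSum_le {a b d : ℕ → ℝ} {n : ℕ}
    (hd : AntitoneOn d (Set.Iic n)) (h : ∀ k ≤ n, partialSum a k ≤ partialSum b k)
    (hn : partialSum a (n + 1) = partialSum b (n + 1)) :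
    ∑ k ∈ Finset.range (n + 1), a k * d k ≤ ∑ k ∈ Finset.range (n + 1), b k * d k := by
  rw [sum_mul_eq_sum_partialSums, sum_mul_eq_sum_partialSums]
  refine add_le_add (Finset.sum_le_sum fun i hi => ?_) (le_of_eq ?_)
  · rw [Finset.mem_range] at hi
    have := hd (Set.mem_Iic.2 hi.le) (Set.mem_Iic.2 (show i + 1 ≤ n by omega)) (by omega)
    exact mul_le_mul_of_nonneg_right (h (i + 1) (by omega)) (sub_nonneg.2 this)
  · exact congrArg (· * d n) hn

theorem permute_apply {n : ℕ} (w : Equiv.Perm (Fin (n + 1))) (v : E n) (k : Fin (n + 1)) :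
    (permute w v).1 k = v.1 (w.symm k) := rfl

theorem sum_coe_eq_zero {n : ℕ} (v : E n) : ∑ k, v.1 k = 0 := v.2

theorem E_inner_eq_sum {n : ℕ} (u v : E n) : inner ℝ u v = ∑ k, u.1 k * v.1 k := by
  rw [Submodule.coe_inner, PiLp.inner_apply]
  exact Finset.sum_congr rfl fun k _ => mul_comm _ _

/-- Rado's theorem. -/
theorem mem_permutohedron_iff {n : ℕ} {l : ℕ → ℝ} (hl : AntitoneOn l (Set.Iic n)) {v : E n}
    (hv : ∀ k : Fin (n + 1), v.1 k = l k) (u : E n) :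
    u ∈ permutohedron v ↔
      ∀ S : Finset (Fin (n + 1)), ∑ i ∈ S, u.1 i ≤ partialSum l S.card := by
  constructor
  · intro hu S
    have hconv : Convex ℝ {u : E n | ∑ i ∈ S, u.1 i ≤ partialSum l S.card} := by
      intro x hx y hy a b ha hb hab
      rw [Set.mem_ofPred_eq] at *
      have : ∑ i ∈ S, (a • x + b • y : E n).1 i = a * ∑ i ∈ S, x.1 i + b * ∑ i ∈ S, y.1 i := by
        rw [Finset.mul_sum, Finset.mul_sum, ← Finset.sum_add_distrib]
        rfl
      rw [this, ← one_mul (partialSum l _), ← hab, add_mul]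
      exact add_le_add (mul_le_mul_of_nonneg_left hx ha) (mul_le_mul_of_nonneg_left hy hb)
    refine convexHull_min ?_ hconv hu
    rintro _ ⟨w, rfl⟩
    rw [Set.mem_ofPred_eq]
    simp only [permute_apply, hv]
    have := sum_le_partialSum hl (S.map w.symm.toEmbedding)
    simpa using this
  · intro hu
    by_contra hnot
    obtain ⟨f, s, hf, hs⟩ := geometric_hahn_banach_closed_point (convex_convexHull ℝ _)
      ((Set.finite_range fun w : Equiv.Perm (Fin (n + 1)) => permute w v).isClosed_convexHull ℝ)
      hnot
    set c : E n := (InnerProductSpace.toDual ℝ (E n)).symm f with hc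
    have hfc : ∀ x, f x = ∑ k, c.1 k * x.1 k := fun x => by
      rw [← E_inner_eq_sum, hc, InnerProductSpace.toDual_symm_apply]
    -- Order the coordinates so that the separating functional c decreases. Abel summation then
    -- shows that f is at least as large at the vertex `permute σ v` as at u, contradicting the
    -- separation.
    set σ := Tuple.sort fun k => -c.1 k with hσ
    have hmono : Monotone ((fun k => -c.1 k) ∘ σ) := Tuple.monotone_sort _
    have h1 := hf (permute σ v) (subset_convexHull ℝ _ ⟨σ, rfl⟩)
    have e1 : f (permute σ v) = ∑ i, v.1 i * c.1 (σ i) := by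
      rw [hfc, ← Equiv.sum_comp σ]
      exact Finset.sum_congr rfl fun i _ => by rw [permute_apply, σ.symm_apply_apply, mul_comm]
    have e2 : f u = ∑ i, u.1 (σ i) * c.1 (σ i) := by
      rw [hfc, ← Equiv.sum_comp σ]
      exact Finset.sum_congr rfl fun i _ => mul_comm _ _
    let d : ℕ → ℝ := fun k => if h : k < n + 1 then c.1 (σ ⟨k, h⟩) else 0
    let a : ℕ → ℝ := fun k => if h : k < n + 1 then u.1 (σ ⟨k, h⟩) else 0
    have hdf : ∀ i : Fin (n + 1), d i = c.1 (σ i) := fun i => dif_pos i.2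
    have haf : ∀ i : Fin (n + 1), a i = u.1 (σ i) := fun i => dif_pos i.2
    have hd : AntitoneOn d (Set.Iic n) := by
      intro i hi j hj hij
      rw [Set.mem_Iic] at hi hj
      have := hmono (show (⟨i, by omega⟩ : Fin (n + 1)) ≤ ⟨j, by omega⟩ from hij)
      simp only [Function.comp, neg_le_neg_iff] at this
      rw [← hdf, ← hdf] at this
      exact this
    have ha : ∀ k ≤ n, partialSum a k ≤ partialSum l k := by
      intro k hk
      have := hu ((Finset.univ : Finset (Fin k)).map
        ((Fin.castLEEmb (by omega : k ≤ n + 1)).trans σ.toEmbedding))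
      rw [Finset.sum_map, Finset.card_map, Finset.card_univ, Fintype.card_fin] at this
      rw [partialSum_eq_sum_fin a]
      refine le_of_eq_of_le (Finset.sum_congr rfl fun i _ => ?_) this
      exact haf (Fin.castLE (by omega) i)
    have htot : partialSum a (n + 1) = partialSum l (n + 1) := by
      rw [partialSum_eq_sum_fin, partialSum_eq_sum_fin]
      simp_rw [haf, ← hv]
      rw [Equiv.sum_comp σ fun i => u.1 i, sum_coe_eq_zero, sum_coe_eq_zero]
    have key := sum_mul_le_sum_mul_of_partialSum_le hd ha htot
    rw [← Fin.sum_univ_eq_sum_range fun k => a k * d k,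
      ← Fin.sum_univ_eq_sum_range fun k => l k * d k] at key
    simp_rw [haf, hdf, ← hv] at key
    rw [← e1, ← e2] at key
    linarith

theorem mem_permutohedron_iff_mem_projPermutohedron {n : ℕ} {l : ℕ → ℝ}
    (hl : AntitoneOn l (Set.Iic n)) {v : E n} (hv : ∀ k : Fin (n + 1), v.1 k = l k) (u : E n) :
    u ∈ permutohedron v ↔ (fun i : Fin n => u.1 i.succ) ∈ projPermutohedron n l := by
  have htot : partialSum l (n + 1) = 0 := by
    rw [partialSum_eq_sum_fin]
    simp_rw [← hv]
    exact sum_coe_eq_zero v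
  have hu : u.1 0 = -∑ i : Fin n, u.1 i.succ := by
    have := sum_coe_eq_zero u
    rw [Fin.sum_univ_succ] at this
    linarith
  rw [mem_permutohedron_iff hl hv, forall_finset_fin_succ]
  simp only [projPermutohedron, Set.mem_ofPred_eq, Finset.sum_map, Finset.sum_cons,
    Finset.card_map, Finset.card_cons, Fin.coe_succEmb, htot, hu]
  -- As the coordinates sum to zero, an upper bound on a set containing 0 is a lower bound on its
  -- complement.
  have hcompl : ∀ S : Finset (Fin n), -∑ i : Fin n, u.1 i.succ + ∑ i ∈ S, u.1 i.succ =
      -∑ i ∈ Sᶜ, u.1 i.succ := fun S => by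
    rw [← Finset.sum_add_sum_compl S]
    ring
  have hcard : ∀ S : Finset (Fin n), S.card + Sᶜ.card = n := fun S => by
    simp [Finset.card_add_card_compl S]
  constructor
  · intro h S
    refine ⟨?_, (h S).1⟩
    have := (h Sᶜ).2
    rw [hcompl, compl_compl] at this
    rw [show n + 1 - S.card = Sᶜ.card + 1 by have := hcard S; omega]
    linarith
  · intro h S
    refine ⟨(h S).2, ?_⟩
    have := (h Sᶜ).1
    rw [hcompl]
    rw [show n + 1 - Sᶜ.card = S.card + 1 by have := hcard S; omega] at this
    linarith

section Hyperplane

open Module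

/-! ### Volumes on the hyperplane -/

/-- The coordinates on `E n` given by all entries but the first. -/
def tailEquiv (n : ℕ) : E n ≃ₗ[ℝ] (Fin n → ℝ) where
  toFun u i := u.1 i.succ
  map_add' _ _ := rfl
  map_smul' _ _ := rfl
  invFun w := ⟨WithLp.toLp 2 (Fin.cons (-∑ i, w i) w), by
    change ∑ k, (Fin.cons (-∑ i, w i) w : Fin (n + 1) → ℝ) k = 0
    rw [Fin.sum_univ_succ]
    simp⟩
  left_inv u := by
    ext k
    have := sum_coe_eq_zero u
    rw [Fin.sum_univ_succ] at this
    refine Fin.cases ?_ (fun i => rfl) k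
    change -∑ i : Fin n, u.1 i.succ = u.1 0
    linarith
  right_inv w := rfl

/-- The basis `ε_i - ε_0`, `1 ≤ i ≤ n`, of `E n`. -/
def tailBasis (n : ℕ) : Basis (Fin n) ℝ (E n) := Basis.ofEquivFun (tailEquiv n)

theorem tailBasis_apply_zero (n : ℕ) (i : Fin n) : (tailBasis n i).1 0 = -1 := by
  classical
  rw [tailBasis, Basis.coe_ofEquivFun]
  change -∑ k, (Pi.single i 1 : Fin n → ℝ) k = -1
  simp

theorem tailBasis_apply_succ (n : ℕ) (i k : Fin n) :
    (tailBasis n i).1 k.succ = if k = i then 1 else 0 := by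
  rw [tailBasis, Basis.coe_ofEquivFun]
  change (Pi.single i 1 : Fin n → ℝ) k = _
  rw [Pi.single_apply]

theorem map_tailBasis_addHaar (n : ℕ) :
    (tailBasis n).addHaar.map (tailEquiv n).toContinuousLinearEquiv = volume := by
  rw [Basis.map_addHaar, ← addHaarMeasure_eq_volume_pi, ← Basis.parallelepiped_basisFun,
    ← Basis.addHaar_def]
  congr 1

theorem tailBasis_addHaar_permutohedron {n : ℕ} {l : ℕ → ℝ} (hl : AntitoneOn l (Set.Iic n))
    {v : E n} (hv : ∀ k : Fin (n + 1), v.1 k = l k) :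
    (tailBasis n).addHaar.real (permutohedron v) = MvPolynomial.eval l (interlacePoly n) := by
  have h1 := volume_projPermutohedron n hl
  have h2 : permutohedron v =
      (tailEquiv n).toContinuousLinearEquiv ⁻¹' projPermutohedron n l := by
    ext u
    exact mem_permutohedron_iff_mem_projPermutohedron hl hv u
  rw [h2, measureReal_def, ← Measure.map_apply (by fun_prop)
    (isClosed_projPermutohedron n l).measurableSet, map_tailBasis_addHaar, h1.1,
    ENNReal.toReal_ofReal h1.2]

theorem weightVector_apply (n : ℕ) (x : ℕ → ℝ) (k : Fin (n + 1)) :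
    (weightVector n x).1 k = (weightVector n x).1 0 - ∑ j ∈ Finset.range k, x (j + 1) := by
  have h : ∀ k : Fin (n + 1), (weightVector n x).1 k = ∑ i ∈ Finset.range n, x (i + 1) *
      ((if (k : ℕ) ≤ i then 1 else 0) - ((i : ℝ) + 1) / ((n : ℝ) + 1)) := by
    intro k
    rw [← Fin.sum_univ_eq_sum_range fun i => x (i + 1) *
      ((if (k : ℕ) ≤ i then 1 else 0) - ((i : ℝ) + 1) / ((n : ℝ) + 1))]
    simp only [weightVector, Submodule.coe_sum, WithLp.ofLp_sum, Finset.sum_apply]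
    rfl
  have hk : (k : ℕ) ≤ n := by omega
  rw [h, h, eq_sub_iff_add_eq]
  have h2 : ∑ j ∈ Finset.range k, x (j + 1) =
      ∑ i ∈ Finset.range n, if i < (k : ℕ) then x (i + 1) else 0 := by
    rw [← Finset.sum_filter]
    congr 1
    ext i
    simp
    omega
  rw [h2, ← Finset.sum_add_distrib]
  refine Finset.sum_congr rfl fun i _ => ?_
  rw [Fin.val_zero, if_pos (Nat.zero_le i)]
  split_ifs
  · omega
  · ring
  · ring
  · omega

theorem tailBasis_addHaar_permutohedron_weightVector (n : ℕ) (x : ℕ → ℝ)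
    (hx : ∀ j ∈ Finset.Icc 1 n, 0 ≤ x j) :
    (tailBasis n).addHaar.real (permutohedron (weightVector n x)) =
      MvPolynomial.eval x (gammaSum n) := by
  -- The first coordinate can stay unevaluated: only differences of entries enter the final formula.
  let l : ℕ → ℝ := fun k => (weightVector n x).1 0 - ∑ j ∈ Finset.range k, x (j + 1)
  have hl : AntitoneOn l (Set.Iic n) := by
    intro a _ b hb hab
    refine sub_le_sub_left (Finset.sum_le_sum_of_subset_of_nonneg
      (Finset.range_mono hab) fun j hj _ => hx _ ?_) _
    rw [Set.mem_Iic] at hb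
    rw [Finset.mem_range] at hj
    rw [Finset.mem_Icc]
    omega
  rw [tailBasis_addHaar_permutohedron hl fun k => weightVector_apply n x k]
  refine eval_interlacePoly_eq_eval_gammaSum n l x fun k => ?_
  simp only [l, Finset.sum_range_succ]
  ring

/-! ### Comparison of the normalizations of the measure on E -/

theorem abs_det_tailBasis_simpleRoot (n : ℕ) : |(tailBasis n).det (simpleRoot n)| = 1 := by
  have hentry : ∀ i j : Fin n, (tailBasis n).toMatrix (simpleRoot n) i j =
      (if i.succ = j.castSucc then 1 else 0) - (if i = j then 1 else 0) := by
    intro i j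
    rw [Basis.toMatrix_apply, tailBasis]
    change (simpleRoot n j).1 i.succ = _
    simp [simpleRoot]
  -- The matrix has -1 on the diagonal, 1 just above it and 0 elsewhere.
  rw [Basis.det_apply, Matrix.det_of_isUpperTriangular]
  · have : ∀ i : Fin n, (tailBasis n).toMatrix (simpleRoot n) i i = -1 := by
      intro i
      rw [hentry, if_neg, if_pos rfl, zero_sub]
      rw [Fin.ext_iff]
      simp
    simp [this]
  · intro i j hij
    change j < i at hij
    rw [hentry, if_neg, if_neg, sub_zero]
    · exact hij.ne'
    · rw [Fin.ext_iff]
      rw [Fin.lt_def] at hij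
      simp
      omega

theorem eq_tailBasis_addHaar {n : ℕ} (μ : Measure (E n)) [μ.IsAddLeftInvariant]
    (h : μ (parallelepiped (simpleRoot n)) = 1) : μ = (tailBasis n).addHaar := by
  have hdet : IsUnit ((tailBasis n).det (simpleRoot n)) := by
    refine isUnit_iff_ne_zero.2 fun h0 => ?_
    have := abs_det_tailBasis_simpleRoot n
    rw [h0, abs_zero] at this
    exact zero_ne_one this
  obtain ⟨hli, hspan⟩ := (Basis.is_basis_iff_det (tailBasis n)).2 hdet
  let b : Basis (Fin n) ℝ (E n) := Basis.mk hli hspan.ge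
  have hb : (b.parallelepiped : Set (E n)) = parallelepiped (simpleRoot n) := by
    rw [Basis.coe_parallelepiped, Basis.coe_mk]
  -- Invariance and a finite nonzero value on one compact set with nonempty interior suffice for a
  -- Haar measure.
  have : μ.IsAddHaarMeasure := Measure.isAddHaarMeasure_of_isCompact_nonempty_interior μ
    b.parallelepiped b.parallelepiped.isCompact b.parallelepiped.interior_nonempty
    (by rw [hb, h]; exact one_ne_zero) (by rw [hb, h]; exact ENNReal.one_ne_top)
  have h1 : b.addHaar = μ := (b.addHaar_eq_iff μ).2 (by rw [hb, h])
  have h2 : b.addHaar = (tailBasis n).addHaar := (b.addHaar_eq_iff _).2 (by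
    rw [hb, Measure.addHaar_parallelepiped, abs_det_tailBasis_simpleRoot, ENNReal.ofReal_one])
  rw [← h1, h2]

theorem abs_det_orthonormalBasis_tailBasis (n : ℕ)
    (b : OrthonormalBasis (Fin n) ℝ (E n)) :
    |b.toBasis.det (tailBasis n)| = Real.sqrt ((n : ℝ) + 1) := by
  -- The Gram matrix of the vectors ε_i - ε_0 is I + J, a rank-one perturbation with determinant 1 +
  -- n.
  have hgram : (b.toBasis.toMatrix (tailBasis n)).transpose * b.toBasis.toMatrix (tailBasis n) =
      1 + Matrix.replicateCol Unit (fun _ => (1 : ℝ)) *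
        Matrix.replicateRow Unit (fun _ => (1 : ℝ)) := by
    ext i j
    rw [Matrix.mul_apply]
    have h1 : ∀ k, (b.toBasis.toMatrix (tailBasis n)).transpose i k *
        b.toBasis.toMatrix (tailBasis n) k j =
          inner ℝ (tailBasis n i) (b k) * inner ℝ (b k) (tailBasis n j) := by
      intro k
      rw [Matrix.transpose_apply, Basis.toMatrix_apply, Basis.toMatrix_apply,
        b.coe_toBasis_repr_apply, b.coe_toBasis_repr_apply, b.repr_apply_apply,
        b.repr_apply_apply, real_inner_comm (b k)]
    simp_rw [h1]
    rw [b.sum_inner_mul_inner, E_inner_eq_sum, Fin.sum_univ_succ]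
    simp_rw [tailBasis_apply_zero, tailBasis_apply_succ]
    simp [Matrix.one_apply, Matrix.mul_apply, add_comm, eq_comm]
  have hdet := congrArg Matrix.det hgram
  rw [Matrix.det_mul, Matrix.det_transpose, Matrix.det_one_add_replicateCol_mul_replicateRow,
    ← Basis.det_apply, ← sq] at hdet
  rw [← Real.sqrt_sq_eq_abs, hdet]
  congr 1
  simp [dotProduct, add_comm]

theorem euclideanVolume_eq (n : ℕ) :
    euclideanVolume n = ENNReal.ofReal (Real.sqrt ((n : ℝ) + 1)) • (tailBasis n).addHaar := by
  have hrank : finrank ℝ (E n) = n := by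
    rw [finrank_eq_card_basis (tailBasis n), Fintype.card_fin]
  have h1 : euclideanVolume n = ((stdOrthonormalBasis ℝ (E n)).reindex
      (finCongr hrank)).toBasis.addHaar := by
    rw [euclideanVolume, OrthonormalBasis.reindex_toBasis, Basis.addHaar_reindex]
  rw [h1, (tailBasis n).addHaar_def, Measure.addHaarMeasure_unique
    ((stdOrthonormalBasis ℝ (E n)).reindex (finCongr hrank)).toBasis.addHaar
    (tailBasis n).parallelepiped, Basis.coe_parallelepiped, Measure.addHaar_parallelepiped,
    abs_det_orthonormalBasis_tailBasis]

theorem isVolumePolynomial_sqrt_mul_gammaSum (n : ℕ) : IsVolumePolynomial n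
    (MvPolynomial.C (Real.sqrt ((n : ℝ) + 1)) * gammaSum n) := by
  intro x hx
  rw [euclideanVolume_eq, measureReal_ennreal_smul_apply,
    tailBasis_addHaar_permutohedron_weightVector n x hx, MvPolynomial.eval_mul,
    MvPolynomial.eval_C, ENNReal.toReal_ofReal (Real.sqrt_nonneg _)]

theorem IsVolumePolynomial.unique {n : ℕ} {V W : MvPolynomial ℕ ℝ} (hV : IsVolumePolynomial n V)
    (hW : IsVolumePolynomial n W) : V = W := by
  refine MvPolynomial.funext_set (fun _ => Set.Ici 0) (fun _ => Set.Ici_infinite 0) fun x hx => ?_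
  have h0 : ∀ j ∈ Finset.Icc 1 n, 0 ≤ x j := fun j _ => hx j (Set.mem_univ j)
  rw [hV x h0, hW x h0]

end Hyperplane

end DyckVolume

end

theorem mainTheorem2 (n : ℕ) :
    (∀ D : DyckVolume.DyckPath n, D.cartanProd = 1 / ((n : ℝ) + 1)) ∧
    (∀ V : MvPolynomial ℕ ℝ, DyckVolume.IsVolumePolynomial n V ↔
      V = MvPolynomial.C (Real.sqrt ((n : ℝ) + 1)) *
        ∑ D : DyckVolume.DyckPath n, D.gammaPoly) ∧
    (∀ μ : MeasureTheory.Measure (DyckVolume.E n), μ.IsAddLeftInvariant →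
      μ (parallelepiped (DyckVolume.simpleRoot n)) = 1 →
      ∀ x : ℕ → ℝ, (∀ j ∈ Finset.Icc 1 n, 0 ≤ x j) →
        μ.real (DyckVolume.permutohedron (DyckVolume.weightVector n x)) =
          MvPolynomial.eval x (∑ D : DyckVolume.DyckPath n, D.gammaPoly)) := by
  refine ⟨fun D => D.cartanProd_eq, fun V => ⟨fun hV => ?_, ?_⟩, fun μ hμ h x hx => ?_⟩
  · exact hV.unique (DyckVolume.isVolumePolynomial_sqrt_mul_gammaSum n)
  · rintro rfl
    exact DyckVolume.isVolumePolynomial_sqrt_mul_gammaSum n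
  · rw [DyckVolume.eq_tailBasis_addHaar μ h]
    exact DyckVolume.tailBasis_addHaar_permutohedron_weightVector n x hx
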